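/- Let $G=(V,E)$ be a connected undirected graph on $n\ge 2$ vertices. Consider a discrete-time Markov chain on $G$ with transition matrix $P$ (that is, $P$ is a stochastic matrix indexed by $V$ with $P_{u,v}=0$ whenever $u\neq v$ and $\{u,v\}\notin E$) and stationary distribution $\pi$. Suppose that the chain is lazy ($P_{u,u}\ge 1/2$ for all $u\in V$), irreducible (for all $x,y\in V$ there is $t\in\mathbb{N}$ with $(P^t)_{x,y}>0$) and reversible ($\pi(u)P_{u,v}=\pi(v)P_{v,u}$ for all $u,v\in V$). Let $\lambda_2$ be the second largest eigenvalue of $P$, counted with multiplicity, and let $\sigma=\max_{u,v\in V}\pi(v)/\pi(u)$. In the local search problem on $G$, an algorithm that knows $G$ has oracle access to an unknown function $f:V\to\mathbb{R}$ (a query names a vertex $v$ and returns $f(v)$) and has to output a vertex $v$ with $f(v)\le f(u)$ for all $\{u,v\}\in E$. Its randomized query complexity is the infimum, over all randomized algorithms that on every input $f$ output such a vertex with probability at least $9/10$, of the maximum (supremum) over $f$ of the expected number of queries. Then the randomized query complexity of local search on $G$ is $$\Omega\left(\frac{(1-\lambda_2)\sqrt{n}}{\log(n)\,\exp(3\sigma)}\right),$$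 that is, it is at least $c\cdot\frac{(1-\lambda_2)\sqrt n}{\log(n)\exp(3\sigma)}$ for a universal constant $c>0$ that does not depend on $n$, $G$, $P$ or $\pi$. -/

import Mathlib

open scoped ENNReal

noncomputable section

namespace LocalSearch

/-! ### Local search and its randomized query complexity -/

/-- `v` is a local minimum of `f` on `G`: no neighbour has a smaller value. -/
def IsLocalMinimum {V : Type*} (G : SimpleGraph V) (f : V → ℝ) (v : V) : Prop :=
  ∀ u, G.Adj v u → f v ≤ f u

/-- A deterministic query algorithm for functions `f : V → ℝ`, as a decision tree. It either stops
and answers with a vertex, or asks for the value of `f` at a vertex and continues in a way that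
depends on the real number it receives. -/
inductive QueryAlgorithm (V : Type*) where
  | answer (v : V) : QueryAlgorithm V
  | query (v : V) (next : ℝ → QueryAlgorithm V) : QueryAlgorithm V

/-- The vertex answered by the algorithm on input `f`. -/
def QueryAlgorithm.output {V : Type*} : QueryAlgorithm V → (V → ℝ) → V
  | .answer v, _ => v
  | .query v next, f => (next (f v)).output f

/-- The number of queries made by the algorithm on input `f`. -/
def QueryAlgorithm.numQueries {V : Type*} : QueryAlgorithm V → (V → ℝ) → ℕ
  | .answer _, _ => 0
  | .query v next, f => (next (f v)).numQueries f + 1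

/-- The smallest σ-algebra for which, for every input `f`, the answer and the number of queries are
measurable functions of the algorithm. -/
instance {V : Type*} : MeasurableSpace (QueryAlgorithm V) :=
  ⨆ f : V → ℝ, MeasurableSpace.comap
    (fun A : QueryAlgorithm V => (A.output f, A.numQueries f)) ⊤

/-- A randomized query algorithm: a probability distribution on deterministic ones (the coin tosses
select the deterministic algorithm that is run). -/
abbrev RandomizedQueryAlgorithm (V : Type*) : Type _ :=
  MeasureTheory.ProbabilityMeasure (QueryAlgorithm V)

/-- On every input, the randomized algorithm answers with a local minimum of the input with
probability at least `9/10`. -/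
def SolvesLocalSearch {V : Type*} (G : SimpleGraph V) (μ : RandomizedQueryAlgorithm V) : Prop :=
  ∀ f : V → ℝ, (9 / 10 : ℝ≥0∞) ≤
    (μ : MeasureTheory.Measure (QueryAlgorithm V)) {A | IsLocalMinimum G f (A.output f)}

/-- The expected number of queries of a randomized algorithm on input `f`. -/
def expectedQueries {V : Type*} (μ : RandomizedQueryAlgorithm V) (f : V → ℝ) : ℝ≥0∞ :=
  ∫⁻ A, (A.numQueries f : ℝ≥0∞) ∂(μ : MeasureTheory.Measure (QueryAlgorithm V))

/-- The randomized query complexity of local search on `G`: the least, over all randomized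
algorithms that succeed with probability at least `9/10` on each input, of the worst-case (over
inputs) expected number of queries. -/
def randomizedQueryComplexity {V : Type*} (G : SimpleGraph V) : ℝ≥0∞ :=
  ⨅ (μ : RandomizedQueryAlgorithm V) (_ : SolvesLocalSearch G μ),
    ⨆ f : V → ℝ, expectedQueries μ f

/-! ### Markov chains on a graph -/

/-- `P` is the transition matrix of a Markov chain on `G`: a row-stochastic matrix that only moves
along edges of `G` or stays put. -/
structure IsChainOn {V : Type*} [Fintype V] (G : SimpleGraph V) (P : Matrix V V ℝ) : Prop where
  nonneg : ∀ u v, 0 ≤ P u v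
  row_sum : ∀ u, ∑ v, P u v = 1
  eq_zero : ∀ u v, u ≠ v → ¬ G.Adj u v → P u v = 0

/-- `π` is a stationary probability distribution of `P`. -/
structure IsStationary {V : Type*} [Fintype V] (P : Matrix V V ℝ) (π : V → ℝ) : Prop where
  nonneg : ∀ v, 0 ≤ π v
  sum_eq_one : ∑ v, π v = 1
  stationary : ∀ v, ∑ u, π u * P u v = π v

/-- Every state is kept with probability at least `1/2`. -/
def IsLazy {V : Type*} (P : Matrix V V ℝ) : Prop :=
  ∀ u, 1 / 2 ≤ P u u

/-- Every state can be reached from every state. -/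
def IsIrreducible {V : Type*} [Fintype V] [DecidableEq V] (P : Matrix V V ℝ) : Prop :=
  ∀ x y, ∃ t : ℕ, 0 < (P ^ t) x y

/-- The detailed balance equations. -/
def IsReversible {V : Type*} (P : Matrix V V ℝ) (π : V → ℝ) : Prop :=
  ∀ u v, π u * P u v = π v * P v u

/-- `σ = max_{u,v} π(v) / π(u)`; the supremum is over a finite set. -/
def maxRatio {V : Type*} (π : V → ℝ) : ℝ :=
  ⨆ p : V × V, π p.2 / π p.1

/-- The second entry of the list of real eigenvalues of `P`, listed with algebraic multiplicity in
decreasing order. A matrix that is reversible with respect to a positive `π` is similar to a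
symmetric one, so the list then has as many entries as there are states, and the default value `0`
is used only if there are fewer than two states. -/
def secondEigenvalue {V : Type*} [Fintype V] [DecidableEq V] (P : Matrix V V ℝ) : ℝ :=
  (P.charpoly.roots.sort (· ≥ ·)).getD 1 0

end LocalSearch

end

/-! The hard inputs come from random walks. For a walk `X` of `K * τ` steps, `pathFunction`
decreases along `X` in the order of last visits and is the distance to the start elsewhere, so its
only local minimum is the endpoint of `X`. Two inputs are paired by choosing a block `k` uniformly,
running `X`, and letting `Y` copy the first `τ * k` steps of `X` before walking independently; the
pair law is symmetric (`pairWeight_comm`).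

An algorithm correct on both members of a pair must make a query that separates them, unless they
share a local minimum (`sum_success_le`). With Markov's inequality this gives a lower bound of order
`1 / γ`, where `γ` bounds the probability that one query separates a pair
(`le_randomizedQueryComplexity`).

A separating vertex lies on the part of `X` or `Y` after the branching time. By symmetry let it be
on `Y`, and regard it as a function `ξ X` of `X` alone. Visits of `Y` more than `τ` steps after
branching are controlled by mixing: for `τ ≥ log n / (1 - λ₂)` all entries of `P ^ τ` are at most
`2σ / n` (`pow_apply_le`). Earlier visits require `X` to be near `ξ X` at the branching time. An
exponential moment and a union bound over vertices show that, on average, even the worst vertex is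
near only `O(log n + K τ σ² / n)` block starts (`sum_pathWeight_mul_sum_le`).

Taking `K ≈ √n` gives `γ = O(σ² log n / ((1 - λ₂) √n))`, and `σ² ≤ exp (3σ)`. For `n < 5σ` the
claimed bound is below a constant that two vertices already force. -/

namespace LocalSearch

open MeasureTheory

/-! ### A relational adversary bound -/

namespace QueryAlgorithm

/-- The algorithm that remains after the first query has been answered according to `f`. -/
def step {V : Type*} : QueryAlgorithm V → (V → ℝ) → QueryAlgorithm V
  | .answer v, _ => .answer v
  | .query v next, f => next (f v)

/-- The vertex queried first, or the answer if there is no query. -/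
def head {V : Type*} : QueryAlgorithm V → V
  | .answer v => v
  | .query v _ => v

/-- The algorithm that remains after `t` queries on input `f`. -/
def after {V : Type*} (A : QueryAlgorithm V) (f : V → ℝ) (t : ℕ) : QueryAlgorithm V :=
  (fun B => B.step f)^[t] A

theorem after_succ {V : Type*} (A : QueryAlgorithm V) (f : V → ℝ) (t : ℕ) :
    A.after f (t + 1) = (A.after f t).step f :=
  Function.iterate_succ_apply' _ _ _

theorem step_congr {V : Type*} (A : QueryAlgorithm V) {f g : V → ℝ} (h : f A.head = g A.head) :
    A.step f = A.step g := by
  cases A with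
  | answer v => rfl
  | query v next => exact congrArg next h

theorem after_eq_answer {V : Type*} (A : QueryAlgorithm V) (f : V → ℝ) (t : ℕ)
    (h : A.numQueries f ≤ t) : A.after f t = .answer (A.output f) := by
  induction t generalizing A with
  | zero =>
    cases A with
    | answer v => rfl
    | query v next => simp [numQueries] at h
  | succ t ih =>
    have hs : A.after f (t + 1) = (A.step f).after f t := Function.iterate_succ_apply _ _ _
    rw [hs]
    cases A with
    | answer v => exact ih (.answer v) (Nat.zero_le _)
    | query v next => exact ih (next (f v)) (by simpa [numQueries] using h)

/-- Just before the runs first diverge they are in the same state and query the same vertex, so only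
different replies can part them. -/
theorem exists_distinguishing_query {V : Type*} (A : QueryAlgorithm V) (f g : V → ℝ) (t : ℕ)
    (h : A.after f t ≠ A.after g t) :
    ∃ s < t, A.after f s = A.after g s ∧ f (A.after f s).head ≠ g (A.after f s).head := by
  induction t with
  | zero => exact absurd rfl h
  | succ t ih =>
    by_cases he : A.after f t = A.after g t
    · refine ⟨t, t.lt_succ_self, he, fun hq => h ?_⟩
      rw [after_succ, after_succ, ← he]
      exact step_congr _ hq
    · obtain ⟨s, hs, h'⟩ := ih he
      exact ⟨s, hs.trans t.lt_succ_self, h'⟩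

/-- The σ-algebra pulls back the discrete one for each single input, so any condition on the answer
and query count on one input is an event. -/
theorem measurableSet_setOf {V : Type*} (f : V → ℝ) (p : V → ℕ → Prop) :
    MeasurableSet {A : QueryAlgorithm V | p (A.output f) (A.numQueries f)} := by
  have hle : MeasurableSpace.comap (fun A : QueryAlgorithm V => (A.output f, A.numQueries f)) ⊤ ≤
      (inferInstance : MeasurableSpace (QueryAlgorithm V)) :=
    le_iSup (fun f : V → ℝ => MeasurableSpace.comap
      (fun A : QueryAlgorithm V => (A.output f, A.numQueries f)) ⊤) f
  exact hle _ ⟨{q | p q.1 q.2}, trivial, rfl⟩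

theorem measurable_numQueries {V : Type*} (f : V → ℝ) :
    Measurable fun A : QueryAlgorithm V => (A.numQueries f : ℝ≥0∞) := by
  intro s _
  exact measurableSet_setOf f (fun _ k => (k : ℝ≥0∞) ∈ s)

open Classical in
/-- A deterministic algorithm that makes few queries is rarely right on both members of a pair. -/
theorem sum_success_le {V : Type*} (G : SimpleGraph V) (A : QueryAlgorithm V) {J : Type*}
    [Fintype J] (w : J → ℝ) (hw : ∀ j, 0 ≤ w j) (hw1 : ∑ j, w j = 1) (f g : J → V → ℝ) (γ δ : ℝ)
    (hδ : ∑ j, (if ∃ v, IsLocalMinimum G (f j) v ∧ IsLocalMinimum G (g j) v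
      then w j else 0) ≤ δ)
    (hγ : ∀ x : (V → ℝ) → V,
      ∑ j, (if x (f j) = x (g j) ∧ f j (x (f j)) ≠ g j (x (f j)) then w j else 0) ≤ γ)
    (T : ℕ) :
    ∑ j, w j * ((if IsLocalMinimum G (f j) (A.output (f j)) ∧ A.numQueries (f j) ≤ T
        then 1 else 0) +
      (if IsLocalMinimum G (g j) (A.output (g j)) ∧ A.numQueries (g j) ≤ T then 1 else 0)) ≤
    1 + δ + T * γ := by
  -- At a fixed time the queried vertex is a function of the input, so adaptivity disappears and
  -- `hγ` applies to each `x t`. Once the algorithm has stopped, `head` is a harmless dummy query.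
  set x : ℕ → (V → ℝ) → V := fun t h => (A.after h t).head
  have key : ∀ j, w j * ((if IsLocalMinimum G (f j) (A.output (f j)) ∧ A.numQueries (f j) ≤ T
        then 1 else 0) +
      (if IsLocalMinimum G (g j) (A.output (g j)) ∧ A.numQueries (g j) ≤ T then 1 else 0)) ≤
      w j + (if ∃ v, IsLocalMinimum G (f j) v ∧ IsLocalMinimum G (g j) v then w j else 0) +
      ∑ t ∈ Finset.range T,
        (if x t (f j) = x t (g j) ∧ f j (x t (f j)) ≠ g j (x t (f j)) then w j else 0) := by
    intro j
    have hj := hw j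
    have hs : ∀ t ∈ Finset.range T, (0 : ℝ) ≤
        (if x t (f j) = x t (g j) ∧ f j (x t (f j)) ≠ g j (x t (f j)) then w j else 0) := by
      intro t _; split_ifs <;> simp [hj]
    have hs0 := Finset.sum_nonneg hs
    have hd0 : (0 : ℝ) ≤
        (if ∃ v, IsLocalMinimum G (f j) v ∧ IsLocalMinimum G (g j) v then w j else 0) := by
      split_ifs <;> simp [hj]
    by_cases h1 : IsLocalMinimum G (f j) (A.output (f j)) ∧ A.numQueries (f j) ≤ T
    swap
    · rw [if_neg h1]; split_ifs <;> linarith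
    by_cases h2 : IsLocalMinimum G (g j) (A.output (g j)) ∧ A.numQueries (g j) ≤ T
    swap
    · rw [if_neg h2]; split_ifs <;> linarith
    rw [if_pos h1, if_pos h2]
    -- Both runs have stopped by time `T`. Equal states give one answer that is a common local
    -- minimum; unequal states give a separating query.
    by_cases he : A.after (f j) T = A.after (g j) T
    · rw [after_eq_answer _ _ _ h1.2, after_eq_answer _ _ _ h2.2] at he
      have ho : A.output (f j) = A.output (g j) := by injection he
      have hc : ∃ v, IsLocalMinimum G (f j) v ∧ IsLocalMinimum G (g j) v :=
        ⟨_, h1.1, ho ▸ h2.1⟩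
      rw [if_pos hc]; linarith
    · obtain ⟨s, hsT, hs1, hs2⟩ := exists_distinguishing_query A _ _ _ he
      have hle := Finset.single_le_sum hs (Finset.mem_range.2 hsT)
      rw [if_pos ⟨congrArg head hs1, hs2⟩] at hle
      linarith
  refine (Finset.sum_le_sum fun j _ => key j).trans ?_
  rw [Finset.sum_add_distrib, Finset.sum_add_distrib, hw1, Finset.sum_comm]
  have : ∑ t ∈ Finset.range T, ∑ j,
      (if x t (f j) = x t (g j) ∧ f j (x t (f j)) ≠ g j (x t (f j)) then w j else 0) ≤
      ∑ t ∈ Finset.range T, γ := Finset.sum_le_sum fun t _ => hγ (x t)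
  rw [Finset.sum_const, Finset.card_range, nsmul_eq_mul] at this
  linarith

end QueryAlgorithm

open Classical in
/-- The relational adversary bound for the randomized query complexity of local search. -/
theorem le_randomizedQueryComplexity {V : Type*} (G : SimpleGraph V) {J : Type*}
    [Fintype J] (w : J → ℝ) (hw : ∀ j, 0 ≤ w j) (hw1 : ∑ j, w j = 1) (f g : J → V → ℝ) (γ δ : ℝ)
    (hδ : ∑ j, (if ∃ v, IsLocalMinimum G (f j) v ∧ IsLocalMinimum G (g j) v
      then w j else 0) ≤ δ)
    (hγ : ∀ x : (V → ℝ) → V,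
      ∑ j, (if x (f j) = x (g j) ∧ f j (x (f j)) ≠ g j (x (f j)) then w j else 0) ≤ γ)
    (T : ℕ) :
    ENNReal.ofReal ((T + 1) * (4 / 5 - δ - T * γ) / 2) ≤ randomizedQueryComplexity G := by
  refine le_iInf₂ fun μ hμ => ?_
  set R : ℝ≥0∞ := ⨆ f : V → ℝ, expectedQueries μ f with hR
  by_cases hRtop : R = ⊤
  · rw [hRtop]; exact le_top
  set ν : Measure (QueryAlgorithm V) := (μ : Measure (QueryAlgorithm V))
  set good : (V → ℝ) → Set (QueryAlgorithm V) :=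
    fun h => {A | IsLocalMinimum G h (A.output h) ∧ A.numQueries h ≤ T}
  have hgm : ∀ h, MeasurableSet (good h) := fun h =>
    QueryAlgorithm.measurableSet_setOf h (fun v k => IsLocalMinimum G h v ∧ k ≤ T)
  have hgood : ∀ h, 9 / 10 - R.toReal / (T + 1) ≤ ν.real (good h) := by
    intro h
    -- Markov's inequality: more than `T` queries occur with probability at most `R / (T + 1)`.
    have hmark : ((T : ℝ≥0∞) + 1) * ν {A | (T : ℝ≥0∞) + 1 ≤ A.numQueries h} ≤ R :=
      (mul_meas_ge_le_lintegral (QueryAlgorithm.measurable_numQueries h) _).trans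
        (le_iSup (fun f : V → ℝ => expectedQueries μ f) h)
    have hset : {A : QueryAlgorithm V | (T : ℝ≥0∞) + 1 ≤ A.numQueries h} =
        {A | ¬ A.numQueries h ≤ T} := by
      ext A
      simp only [Set.mem_ofPred_eq, not_le]
      exact_mod_cast Nat.succ_le_iff
    rw [hset] at hmark
    have h1 : (T + 1 : ℝ) * ν.real {A | ¬ A.numQueries h ≤ T} ≤ R.toReal := by
      have := ENNReal.toReal_mono hRtop hmark
      rw [ENNReal.toReal_mul] at this
      simpa [Measure.real, ENNReal.toReal_add] using this
    have h2 : (9 / 10 : ℝ) ≤ ν.real {A | IsLocalMinimum G h (A.output h)} := by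
      have := ENNReal.toReal_mono (measure_ne_top _ _) (hμ h)
      simpa [Measure.real] using this
    have h3 : ν.real {A | IsLocalMinimum G h (A.output h)} ≤
        ν.real (good h) + ν.real {A | ¬ A.numQueries h ≤ T} := by
      refine (measureReal_mono ?_).trans (measureReal_union_le _ _)
      intro A hA
      by_cases hq : A.numQueries h ≤ T
      · exact Or.inl ⟨hA, hq⟩
      · exact Or.inr hq
    have h4 : ν.real {A | ¬ A.numQueries h ≤ T} ≤ R.toReal / (T + 1) := by
      rw [le_div_iff₀ (by positivity)]; linarith
    linarith
  have hint : ∑ j, w j * (ν.real (good (f j)) + ν.real (good (g j))) ≤ 1 + δ + T * γ := by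
    have hI : ∀ h, Integrable ((good h).indicator (1 : QueryAlgorithm V → ℝ)) ν := fun h =>
      (integrable_const (1 : ℝ)).indicator (hgm h)
    have hI2 : ∀ j, Integrable (fun A => w j * ((good (f j)).indicator
        (1 : QueryAlgorithm V → ℝ) A + (good (g j)).indicator (1 : QueryAlgorithm V → ℝ) A)) ν :=
      fun j => ((hI _).add (hI _)).const_mul _
    have heq : ∑ j, w j * (ν.real (good (f j)) + ν.real (good (g j))) =
        ∫ A, ∑ j, w j * ((good (f j)).indicator (1 : QueryAlgorithm V → ℝ) A +
          (good (g j)).indicator (1 : QueryAlgorithm V → ℝ) A) ∂ν := by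
      rw [integral_finsetSum _ fun j _ => hI2 j]
      refine Finset.sum_congr rfl fun j _ => ?_
      rw [integral_const_mul, integral_add (hI _) (hI _), integral_indicator_one (hgm _),
        integral_indicator_one (hgm _)]
    rw [heq]
    have hb : ∀ A : QueryAlgorithm V,
        ∑ j, w j * ((good (f j)).indicator (1 : QueryAlgorithm V → ℝ) A +
          (good (g j)).indicator (1 : QueryAlgorithm V → ℝ) A) ≤ 1 + δ + T * γ := by
      intro A
      refine le_trans (le_of_eq ?_) (A.sum_success_le G w hw hw1 f g γ δ hδ hγ T)
      simp only [Set.indicator_apply, Pi.one_apply, good, Set.mem_ofPred_eq]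
    calc _ ≤ ∫ _, (1 + δ + T * γ) ∂ν :=
          integral_mono (integrable_finsetSum _ fun j _ => hI2 j)
            (integrable_const _) hb
      _ = _ := by simp
  have hlow : 2 * (9 / 10 - R.toReal / (T + 1)) ≤
      ∑ j, w j * (ν.real (good (f j)) + ν.real (good (g j))) := by
    calc 2 * (9 / 10 - R.toReal / (T + 1)) = ∑ j, w j * (2 * (9 / 10 - R.toReal / (T + 1))) := by
          rw [← Finset.sum_mul, hw1, one_mul]
      _ ≤ _ := Finset.sum_le_sum fun j _ => mul_le_mul_of_nonneg_left
          (by linarith [hgood (f j), hgood (g j)]) (hw j)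
  refine ENNReal.ofReal_le_of_le_toReal ?_
  have hT : (0 : ℝ) < T + 1 := by positivity
  have h5 : (4 / 5 - δ - T * γ) / 2 ≤ R.toReal / (T + 1) := by linarith
  rw [le_div_iff₀ hT] at h5
  linarith

end LocalSearch

namespace LocalSearch

/-! ### Mixing of lazy reversible chains -/

/-- Only the index `i₀` can carry the eigenvalue one, so the unit fixed vector `r` is, up to sign,
the eigenvector at `i₀` and contributes `r u * r x`. The remaining terms carry factors at most `l ^
s`, and the rows of the eigenvector matrix are unit vectors. -/
theorem _root_.Matrix.IsHermitian.abs_pow_apply_sub_le {V : Type*} [Fintype V] [DecidableEq V]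
    {A : Matrix V V ℝ} (hA : A.IsHermitian) (hpos : ∀ j, 0 ≤ hA.eigenvalues j) (r : V → ℝ)
    (hr : ∀ u, ∑ x, A u x * r x = r u) (hr1 : ∑ u, r u ^ 2 = 1) (i₀ : V) (l : ℝ) (hl0 : 0 ≤ l) (hl : l < 1)
    (hle : ∀ j, j ≠ i₀ → hA.eigenvalues j ≤ l) (s : ℕ) (u x : V) :
    |(A ^ s) u x - r u * r x| ≤ l ^ s := by
  set U : V → V → ℝ := fun u j => (hA.eigenvectorUnitary : Matrix V V ℝ) u j with hU
  set c : V → ℝ := hA.eigenvalues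
  have h1 : ∀ u x, ∑ j, U u j * U x j = if u = x then 1 else 0 := by
    intro u x
    have := congrFun (congrFun (Unitary.coe_mul_star_self hA.eigenvectorUnitary) u) x
    simpa [Matrix.mul_apply, Matrix.one_apply, Matrix.star_apply, hU] using this
  have h2 : ∀ i j, ∑ u, U u i * U u j = if i = j then 1 else 0 := by
    intro i j
    have := congrFun (congrFun (Unitary.coe_star_mul_self hA.eigenvectorUnitary) i) j
    simpa [Matrix.mul_apply, Matrix.one_apply, Matrix.star_apply, hU] using this
  have h3 : ∀ (s : ℕ) u x, (A ^ s) u x = ∑ j, c j ^ s * (U u j * U x j) := by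
    intro s u x
    have hs : A ^ s = hA.eigenvectorUnitary * (Matrix.diagonal c) ^ s *
        star (hA.eigenvectorUnitary : Matrix V V ℝ) := by
      have h := hA.spectral_theorem
      have h' := congrArg (· ^ s) h
      simp only [← map_pow] at h'
      rw [h', Unitary.conjStarAlgAut_apply]
      rfl
    rw [hs, Matrix.diagonal_pow, Matrix.mul_apply]
    refine Finset.sum_congr rfl fun j _ => ?_
    rw [Matrix.mul_diagonal, Matrix.star_apply, Pi.pow_apply]
    simp only [hU, star_trivial]
    ring
  obtain ⟨d, hd⟩ : ∃ d : V → ℝ, ∀ j, d j = ∑ u, U u j * r u := ⟨_, fun _ => rfl⟩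
  have hcd : ∀ i, c i * d i = d i := by
    intro i
    have hru : ∀ u, r u = ∑ j, c j * d j * U u j := by
      intro u
      have h := hr u
      have h31 : ∀ x, A u x = ∑ j, c j * (U u j * U x j) := by
        intro x; simpa using h3 1 u x
      simp only [h31, Finset.sum_mul] at h
      rw [← h, Finset.sum_comm]
      refine Finset.sum_congr rfl fun j _ => ?_
      simp only [hd, Finset.mul_sum, Finset.sum_mul]
      exact Finset.sum_congr rfl fun y _ => by ring
    have hdi : d i = ∑ u, U u i * ∑ j, c j * d j * U u j := by
      rw [hd]
      exact Finset.sum_congr rfl fun u _ => by rw [hru u]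
    refine Eq.symm (hdi.trans ?_)
    simp only [Finset.mul_sum]
    rw [Finset.sum_comm]
    have : ∀ j, ∑ u, U u i * (c j * d j * U u j) = c j * d j * if i = j then 1 else 0 := by
      intro j
      rw [← h2 i j, Finset.mul_sum]
      exact Finset.sum_congr rfl fun u _ => by ring
    simp [this]
  -- `d j` is the coordinate of `r` along the `j`-th eigenvector; being fixed by `A` kills it
  -- wherever the eigenvalue is below one.
  have hd0 : ∀ j, j ≠ i₀ → d j = 0 := by
    intro j hj
    have h := hcd j
    have : (1 - c j) * d j = 0 := by linarith
    rcases mul_eq_zero.1 this with h' | h'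
    · have := hle j hj; linarith
    · exact h'
  have hr2 : ∀ u, r u = d i₀ * U u i₀ := by
    intro u
    have : r u = ∑ j, d j * U u j := by
      calc r u = ∑ x, r x * if u = x then 1 else 0 := by simp
        _ = ∑ x, r x * ∑ j, U u j * U x j := by simp only [h1]
        _ = ∑ j, d j * U u j := by
          simp only [hd, Finset.mul_sum, Finset.sum_mul]
          rw [Finset.sum_comm]
          exact Finset.sum_congr rfl fun _ _ => Finset.sum_congr rfl fun _ _ => by ring
    rw [this, Finset.sum_eq_single i₀]
    · intro j _ hj; rw [hd0 j hj, zero_mul]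
    · intro h; exact absurd (Finset.mem_univ _) h
  have hd1 : d i₀ ^ 2 = 1 := by
    have h := h2 i₀ i₀
    rw [if_pos rfl] at h
    calc d i₀ ^ 2 = d i₀ ^ 2 * ∑ u, U u i₀ * U u i₀ := by rw [h, mul_one]
      _ = ∑ u, r u ^ 2 := by
        rw [Finset.mul_sum]
        exact Finset.sum_congr rfl fun u _ => by rw [hr2 u]; ring
      _ = 1 := hr1
  have hc1 : c i₀ = 1 := by
    have h := hcd i₀
    have hne : d i₀ ≠ 0 := by intro h0; rw [h0] at hd1; norm_num at hd1
    exact mul_right_cancel₀ hne (by rw [h, one_mul])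
  have hrr : r u * r x = U u i₀ * U x i₀ := by
    rw [hr2 u, hr2 x]; linear_combination (U u i₀ * U x i₀) * hd1
  rw [h3, ← Finset.add_sum_erase _ _ (Finset.mem_univ i₀), hc1, one_pow, one_mul, hrr,
    add_sub_cancel_left]
  have hterm : ∀ j ∈ Finset.univ.erase i₀, |c j ^ s * (U u j * U x j)| ≤
      l ^ s * ((U u j * U u j + U x j * U x j) / 2) := by
    intro j hj
    have hcl := hle j (Finset.ne_of_mem_erase hj)
    rw [abs_mul, abs_of_nonneg (pow_nonneg (hpos j) s)]
    have h4 : |U u j * U x j| ≤ (U u j * U u j + U x j * U x j) / 2 := by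
      rw [abs_le]; constructor <;> nlinarith [sq_nonneg (U u j - U x j), sq_nonneg (U u j + U x j)]
    exact mul_le_mul (pow_le_pow_left₀ (hpos j) hcl s) h4 (abs_nonneg _)
      (pow_nonneg ((hpos j).trans hcl) s)
  refine (Finset.abs_sum_le_sum_abs _ _).trans ((Finset.sum_le_sum hterm).trans ?_)
  have hls : 0 ≤ l ^ s := pow_nonneg hl0 s
  rw [← Finset.mul_sum]
  have : ∑ j ∈ Finset.univ.erase i₀, (U u j * U u j + U x j * U x j) / 2 ≤
      ∑ j, (U u j * U u j + U x j * U x j) / 2 :=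
    Finset.sum_le_sum_of_subset_of_nonneg (Finset.erase_subset _ _) fun j _ _ => by
      nlinarith [mul_self_nonneg (U u j), mul_self_nonneg (U x j)]
  have h5 : ∑ j, (U u j * U u j + U x j * U x j) / 2 = 1 := by
    rw [← Finset.sum_div, Finset.sum_add_distrib, h1, h1, if_pos rfl, if_pos rfl]; norm_num
  rw [h5] at this
  nlinarith

/-- Gershgorin: each disc has centre `P k k ≥ 1/2` and radius `1 - P k k ≤ 1/2`. -/
theorem _root_.Matrix.eigenvalue_nonneg_of_lazy {V : Type*} [Fintype V] [DecidableEq V]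
    {P : Matrix V V ℝ} (h0 : ∀ u v, 0 ≤ P u v) (h1 : ∀ u, ∑ v, P u v = 1) (hlazy : IsLazy P)
    {l : ℝ} (hl : P.charpoly.IsRoot l) : 0 ≤ l := by
  have hev : Module.End.HasEigenvalue (Matrix.toLin' P) l := by
    rw [Module.End.hasEigenvalue_iff_isRoot_charpoly, Matrix.charpoly_toLin']
    exact hl
  obtain ⟨k, hk⟩ := eigenvalue_mem_ball hev
  rw [Metric.mem_closedBall, Real.dist_eq] at hk
  have hs : ∑ j ∈ Finset.univ.erase k, ‖P k j‖ = 1 - P k k := by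
    rw [← h1 k, ← Finset.add_sum_erase _ _ (Finset.mem_univ k), add_sub_cancel_left]
    exact Finset.sum_congr rfl fun j _ => Real.norm_of_nonneg (h0 k j)
  rw [hs] at hk
  have := (abs_le.1 hk).1
  have := hlazy k
  linarith

/-! ### Powers, stationary distribution and symmetrization of a reversible chain. -/

section Chain

variable {n : ℕ} {G : SimpleGraph (Fin n)} {P : Matrix (Fin n) (Fin n) ℝ} {π : Fin n → ℝ}

theorem IsStationary.sum_mul_pow (hπ : IsStationary P π) (t : ℕ) (v : Fin n) :
    ∑ u, π u * (P ^ t) u v = π v := by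
  have h1 : Matrix.vecMul π P = π := funext hπ.stationary
  have h2 : Matrix.vecMul π (P ^ t) = π := by
    induction t with
    | zero => simp
    | succ t ih => rw [pow_succ, ← Matrix.vecMul_vecMul, ih, h1]
  exact congrFun h2 v

theorem IsChainOn.pow_nonneg (hP : IsChainOn G P) (t : ℕ) (u v : Fin n) : 0 ≤ (P ^ t) u v := by
  induction t generalizing u v with
  | zero => rw [pow_zero, Matrix.one_apply]; split_ifs <;> norm_num
  | succ t ih =>
    rw [pow_succ, Matrix.mul_apply]
    exact Finset.sum_nonneg fun w _ => mul_nonneg (ih u w) (hP.nonneg w v)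

theorem IsChainOn.pow_row_sum (hP : IsChainOn G P) (t : ℕ) (u : Fin n) :
    ∑ v, (P ^ t) u v = 1 := by
  have h1 : Matrix.mulVec P 1 = 1 := by
    funext u; simpa [Matrix.mulVec, dotProduct] using hP.row_sum u
  have h2 : Matrix.mulVec (P ^ t) 1 = 1 := by
    induction t with
    | zero => simp
    | succ t ih => rw [pow_succ, ← Matrix.mulVec_mulVec, h1, ih]
  simpa [Matrix.mulVec, dotProduct] using congrFun h2 u

theorem IsStationary.pos (hP : IsChainOn G P) (hπ : IsStationary P π) (hirr : IsIrreducible P)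
    (v : Fin n) : 0 < π v := by
  obtain ⟨x, -, hx⟩ : ∃ x ∈ Finset.univ, 0 < π x := by
    by_contra! h
    have := Finset.sum_nonpos h
    rw [hπ.sum_eq_one] at this
    norm_num at this
  obtain ⟨t, ht⟩ := hirr x v
  rw [← hπ.sum_mul_pow t v]
  exact (mul_pos hx ht).trans_le (Finset.single_le_sum
    (fun u _ => mul_nonneg (hπ.nonneg u) (hP.pow_nonneg t u v)) (Finset.mem_univ x))

theorem div_le_maxRatio (π : Fin n → ℝ) (u v : Fin n) : π v / π u ≤ maxRatio π :=
  le_ciSup (f := fun p : Fin n × Fin n => π p.2 / π p.1) (Set.finite_range _).bddAbove (u, v)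

theorem one_le_maxRatio (hpos : ∀ v, 0 < π v) (v : Fin n) : 1 ≤ maxRatio π :=
  (div_self (hpos v).ne').symm.le.trans (div_le_maxRatio π v v)

theorem IsStationary.mul_le_maxRatio (hπ : IsStationary P π) (hpos : ∀ v, 0 < π v) (v : Fin n) :
    n * π v ≤ maxRatio π := by
  have h : ∑ _u : Fin n, π v ≤ ∑ u, maxRatio π * π u := Finset.sum_le_sum fun u _ =>
    (div_le_iff₀ (hpos u)).1 (div_le_maxRatio π u v)
  rw [← Finset.mul_sum, hπ.sum_eq_one, mul_one] at h
  simpa using h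

theorem IsReversible.pow (hrev : IsReversible P π) (t : ℕ) : IsReversible (P ^ t) π := by
  induction t with
  | zero =>
    intro u v
    by_cases h : u = v
    · rw [h]
    · simp [h, Ne.symm h]
  | succ t ih =>
    intro u v
    rw [pow_succ, Matrix.mul_apply, ← pow_succ, pow_succ', Matrix.mul_apply, Finset.mul_sum,
      Finset.mul_sum]
    refine Finset.sum_congr rfl fun w _ => ?_
    linear_combination (P w v) * ih u w + (P ^ t) w u * hrev w v

/-- Reversibility turns a column into a row at the cost of a ratio of stationary masses, and rows
sum to one. -/
theorem sum_pow_apply_le (hP : IsChainOn G P) (hpos : ∀ v, 0 < π v) (hrev : IsReversible P π)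
    (t : ℕ) (x : Fin n) : ∑ y, (P ^ t) y x ≤ maxRatio π := by
  have h : ∀ y, (P ^ t) y x ≤ maxRatio π * (P ^ t) x y := by
    intro y
    have h1 := hrev.pow t y x
    have h2 : (P ^ t) y x = π x / π y * (P ^ t) x y := by
      field_simp [(hpos y).ne']
      linarith
    rw [h2]
    exact mul_le_mul_of_nonneg_right (div_le_maxRatio π y x) (hP.pow_nonneg t x y)
  refine (Finset.sum_le_sum fun y _ => h y).trans ?_
  rw [← Finset.mul_sum, hP.pow_row_sum, mul_one]

/-- The symmetric matrix similar to the transition matrix of a reversible chain. -/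
noncomputable def symmetrization (P : Matrix (Fin n) (Fin n) ℝ) (π : Fin n → ℝ) : Matrix (Fin n) (Fin n) ℝ :=
  Matrix.diagonal (fun u => √(π u)) * P * Matrix.diagonal (fun u => (√(π u))⁻¹)

theorem symmetrization_pow (hpos : ∀ v, 0 < π v) (s : ℕ) :
    symmetrization P π ^ s = symmetrization (P ^ s) π := by
  have hne : ∀ u, √(π u) ≠ 0 := fun u => (Real.sqrt_pos.2 (hpos u)).ne'
  have hinv : Matrix.diagonal (fun u => (√(π u))⁻¹) * Matrix.diagonal (fun u => √(π u)) = 1 := by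
    rw [Matrix.diagonal_mul_diagonal, ← Matrix.diagonal_one]
    congr 1
    funext u
    exact inv_mul_cancel₀ (hne u)
  have hinv' : Matrix.diagonal (fun u => √(π u)) * Matrix.diagonal (fun u => (√(π u))⁻¹) = 1 := by
    rw [Matrix.diagonal_mul_diagonal, ← Matrix.diagonal_one]
    congr 1
    funext u
    exact mul_inv_cancel₀ (hne u)
  induction s with
  | zero => rw [pow_zero, pow_zero, symmetrization, mul_one, hinv']
  | succ s ih =>
    rw [pow_succ, ih, symmetrization, symmetrization, symmetrization, pow_succ]
    calc _ = Matrix.diagonal (fun u => √(π u)) * P ^ s *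
        (Matrix.diagonal (fun u => (√(π u))⁻¹) * Matrix.diagonal (fun u => √(π u))) * P *
          Matrix.diagonal (fun u => (√(π u))⁻¹) := by simp only [mul_assoc]
      _ = _ := by rw [hinv, mul_one]; simp only [mul_assoc]

theorem symmetrization_apply (u v : Fin n) :
    symmetrization P π u v = √(π u) * P u v * (√(π v))⁻¹ := by
  rw [symmetrization, Matrix.mul_diagonal, Matrix.diagonal_mul]

theorem symmetrization_charpoly (hpos : ∀ v, 0 < π v) :
    (symmetrization P π).charpoly = P.charpoly := by
  have hinv : Matrix.diagonal (fun u => (√(π u))⁻¹) * Matrix.diagonal (fun u => √(π u)) = 1 := by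
    rw [Matrix.diagonal_mul_diagonal, ← Matrix.diagonal_one]
    congr 1
    funext u
    exact inv_mul_cancel₀ (Real.sqrt_pos.2 (hpos u)).ne'
  rw [symmetrization, Matrix.charpoly_mul_comm, ← mul_assoc, hinv, one_mul]

theorem symmetrization_isHermitian (hpos : ∀ v, 0 < π v) (hrev : IsReversible P π) :
    (symmetrization P π).IsHermitian := by
  ext u v
  rw [Matrix.conjTranspose_apply, star_trivial, symmetrization_apply, symmetrization_apply]
  have hu := Real.sqrt_pos.2 (hpos u)
  have hv := Real.sqrt_pos.2 (hpos v)
  have h := hrev u v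
  rw [← Real.mul_self_sqrt (hpos u).le, ← Real.mul_self_sqrt (hpos v).le] at h
  field_simp
  nlinarith

/-- Similarity preserves the characteristic polynomial, and `eigenvalues₀` is already in decreasing
order. -/
theorem secondEigenvalue_eq (hn : 2 ≤ n) (hpos : ∀ v, 0 < π v) (hrev : IsReversible P π) :
    secondEigenvalue P = (symmetrization_isHermitian hpos hrev).eigenvalues₀
      ⟨1, by rw [Fintype.card_fin]; omega⟩ := by
  have h := (symmetrization_isHermitian hpos hrev).sort_roots_charpoly_eq_eigenvalues₀
  have hre : (RCLike.re : ℝ → ℝ) = id := by funext x; simp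
  rw [hre, Multiset.map_id, symmetrization_charpoly hpos] at h
  rw [secondEigenvalue, h]
  have hlen : 1 < (List.ofFn (symmetrization_isHermitian hpos hrev).eigenvalues₀).length := by
    rw [List.length_ofFn, Fintype.card_fin]; omega
  rw [List.getD_eq_getElem _ _ hlen, List.getElem_ofFn]

theorem symmetrization_eigenvalues_nonneg (hP : IsChainOn G P) (hlazy : IsLazy P)
    (hpos : ∀ v, 0 < π v) (hrev : IsReversible P π) (j : Fin n) :
    0 ≤ (symmetrization_isHermitian hpos hrev).eigenvalues j := by
  refine Matrix.eigenvalue_nonneg_of_lazy hP.nonneg hP.row_sum hlazy ?_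
  rw [← symmetrization_charpoly hpos, (symmetrization_isHermitian hpos hrev).charpoly_eq,
    Polynomial.IsRoot, Polynomial.eval_prod]
  exact Finset.prod_eq_zero (Finset.mem_univ j) (by simp)

theorem secondEigenvalue_nonneg (hn : 2 ≤ n) (hP : IsChainOn G P) (hlazy : IsLazy P)
    (hpos : ∀ v, 0 < π v) (hrev : IsReversible P π) : 0 ≤ secondEigenvalue P := by
  rw [secondEigenvalue_eq hn hpos hrev]
  have h := symmetrization_eigenvalues_nonneg hP hlazy hpos hrev
    (Fintype.equivOfCardEq (Fintype.card_fin _) ⟨1, by rw [Fintype.card_fin]; omega⟩)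
  simpa [Matrix.IsHermitian.eigenvalues] using h

/-- After `log n / (1 - λ₂)` steps the chain is spread out. -/
theorem pow_apply_le (hn : 2 ≤ n) (hP : IsChainOn G P) (hπ : IsStationary P π) (hlazy : IsLazy P)
    (hpos : ∀ v, 0 < π v) (hrev : IsReversible P π) (hl : secondEigenvalue P < 1) (s : ℕ)
    (hs : Real.log n ≤ (1 - secondEigenvalue P) * s) (u x : Fin n) :
    (P ^ s) u x ≤ 2 * maxRatio π / n := by
  set l := secondEigenvalue P with hldef
  have hl0 : 0 ≤ l := secondEigenvalue_nonneg hn hP hlazy hpos hrev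
  have hn0 : (0 : ℝ) < n := by positivity
  have hA := symmetrization_isHermitian hpos hrev
  have hsq : ∀ v, 0 < √(π v) := fun v => Real.sqrt_pos.2 (hpos v)
  have hspec := hA.abs_pow_apply_sub_le (symmetrization_eigenvalues_nonneg hP hlazy hpos hrev)
    (fun v => √(π v)) (by
      intro v
      have : ∀ y, symmetrization P π v y * √(π y) = √(π v) * P v y := by
        intro y
        rw [symmetrization_apply, mul_assoc, inv_mul_cancel₀ (hsq y).ne', mul_one]
      simp only [this]
      rw [← Finset.mul_sum, hP.row_sum, mul_one])
    (by
      rw [← hπ.sum_eq_one]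
      exact Finset.sum_congr rfl fun v _ => Real.sq_sqrt (hpos v).le)
    (Fintype.equivOfCardEq (Fintype.card_fin _) ⟨0, by rw [Fintype.card_fin]; omega⟩)
    l hl0 hl (by
      intro j hj
      rw [hldef, secondEigenvalue_eq hn hpos hrev]
      refine hA.eigenvalues₀_antitone ?_
      rw [Fin.le_def]
      by_contra hlt
      refine hj ?_
      rw [← Equiv.symm_apply_eq]
      refine Fin.ext ?_
      simp only at hlt ⊢
      omega) s u x
  -- Uses `l ≤ exp (-(1 - l))` and the assumed length of `s`.
  have hls : l ^ s ≤ 1 / n := by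
    have h1 : l ≤ Real.exp (-(1 - l)) := by
      have := Real.add_one_le_exp (-(1 - l)); linarith
    calc l ^ s ≤ Real.exp (-(1 - l)) ^ s := pow_le_pow_left₀ hl0 h1 s
      _ = Real.exp (-((1 - l) * s)) := by rw [← Real.exp_nat_mul]; ring_nf
      _ ≤ Real.exp (-Real.log n) := Real.exp_le_exp.2 (by linarith)
      _ = 1 / n := by rw [Real.exp_neg, Real.exp_log hn0, one_div]
  rw [symmetrization_pow hpos, symmetrization_apply] at hspec
  have h1 : √(π u) * (P ^ s) u x * (√(π x))⁻¹ ≤ √(π u) * √(π x) + 1 / n := by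
    have := (abs_le.1 hspec).2; linarith
  -- Undoing the symmetrization multiplies the error by `√(π x / π u)`, which is at most `√σ ≤ σ`.
  have h2 : (P ^ s) u x ≤ π x + √(π x) / √(π u) * (1 / n) := by
    have h3 := mul_le_mul_of_nonneg_left h1 (div_pos (hsq x) (hsq u)).le
    have h4 : √(π x) / √(π u) * (√(π u) * (P ^ s) u x * (√(π x))⁻¹) = (P ^ s) u x := by
      field_simp [(hsq x).ne', (hsq u).ne']
    have h5 : √(π x) / √(π u) * (√(π u) * √(π x) + 1 / n) =
        π x + √(π x) / √(π u) * (1 / n) := by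
      have : √(π x) / √(π u) * (√(π u) * √(π x)) = π x := by
        rw [← mul_assoc, div_mul_cancel₀ _ (hsq u).ne', Real.mul_self_sqrt (hpos x).le]
      rw [mul_add, this]
    linarith
  have hσ1 := one_le_maxRatio hpos x
  have h6 : √(π x) / √(π u) ≤ maxRatio π := by
    rw [← Real.sqrt_div (hpos x).le, Real.sqrt_le_left (by linarith)]
    have := div_le_maxRatio π u x
    nlinarith
  have h7 : π x ≤ maxRatio π / n := by
    rw [le_div_iff₀ hn0]; linarith [hπ.mul_le_maxRatio hpos x]
  have h8 : √(π x) / √(π u) * (1 / n) ≤ maxRatio π / n := by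
    rw [mul_one_div]; gcongr
  calc (P ^ s) u x ≤ maxRatio π / n + maxRatio π / n := by linarith
    _ = 2 * maxRatio π / n := by ring

end Chain

end LocalSearch

namespace LocalSearch

/-! ### Weights of paths -/

section Paths

variable {V : Type*} [Fintype V] [DecidableEq V]

/-- The weight of a path started at `u` under the successive transition matrices `M`. -/
def pathWeight {L : ℕ} (M : Fin L → Matrix V V ℝ) (u : V) (X : Fin (L + 1) → V) : ℝ :=
  if X 0 = u then ∏ i, M i (X i.castSucc) (X i.succ) else 0

theorem sum_pathWeight_zero (M : Fin 0 → Matrix V V ℝ) (u : V) (φ : (Fin 1 → V) → ℝ) :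
    ∑ X, pathWeight M u X * φ X = φ (fun _ => u) := by
  rw [Finset.sum_eq_single (fun _ => u)]
  · simp [pathWeight]
  · intro X _ hX
    have : X 0 ≠ u := fun h => hX (funext fun i => by rw [Fin.fin_one_eq_zero i, h])
    rw [pathWeight, if_neg this, zero_mul]
  · intro h; exact absurd (Finset.mem_univ _) h

/-- Conditioning on the first step; the inductions on path length rest on this identity. -/
theorem sum_pathWeight_succ {L : ℕ} (M : Fin (L + 1) → Matrix V V ℝ) (u : V)
    (φ : (Fin (L + 2) → V) → ℝ) :
    ∑ X, pathWeight M u X * φ X =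
      ∑ v, M 0 u v * ∑ Y, pathWeight (fun i => M i.succ) v Y * φ (Fin.cons u Y) := by
  rw [← (Fin.consEquiv (fun _ : Fin (L + 2) => V)).sum_comp, Fintype.sum_prod_type]
  rw [Finset.sum_eq_single u]
  · simp only [Finset.mul_sum]
    rw [Finset.sum_comm]
    refine Finset.sum_congr rfl fun Y _ => ?_
    rw [Finset.sum_eq_single (Y 0)]
    · have : (Fin.consEquiv fun _ : Fin (L + 2) => V) (u, Y) = Fin.cons u Y := rfl
      simp only [this, pathWeight, Fin.cons_zero, if_true, Fin.prod_univ_succ,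
        Fin.castSucc_zero, Fin.cons_succ, ← Fin.succ_castSucc]
      ring
    · intro v _ hv
      rw [pathWeight, if_neg (Ne.symm hv)]; ring
    · intro h; exact absurd (Finset.mem_univ _) h
  · intro a _ ha
    refine Finset.sum_eq_zero fun Y _ => ?_
    rw [pathWeight, if_neg (by simpa using ha), zero_mul]
  · intro h; exact absurd (Finset.mem_univ _) h

omit [Fintype V] in
theorem pathWeight_nonneg {L : ℕ} {M : Fin L → Matrix V V ℝ} (hM : ∀ i u v, 0 ≤ M i u v) (u : V)
    (X : Fin (L + 1) → V) : 0 ≤ pathWeight M u X := by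
  rw [pathWeight]
  split_ifs
  · exact Finset.prod_nonneg fun i _ => hM i _ _
  · exact le_rfl

theorem sum_pathWeight {L : ℕ} {M : Fin L → Matrix V V ℝ} (hM : ∀ i u, ∑ v, M i u v = 1) (u : V) :
    ∑ X, pathWeight M u X = 1 := by
  induction L generalizing u with
  | zero => simpa using sum_pathWeight_zero M u (fun _ => 1)
  | succ L ih =>
    have h := sum_pathWeight_succ M u (fun _ => 1)
    simp only [mul_one] at h
    rw [h, ← hM 0 u]
    exact Finset.sum_congr rfl fun v _ => by rw [ih (fun i => hM i.succ) v, mul_one]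

theorem sum_pathWeight_const_marginal {P : Matrix V V ℝ} (hP : ∀ u, ∑ v, P u v = 1) {L : ℕ}
    (i : Fin (L + 1)) (u x : V) :
    ∑ X : Fin (L + 1) → V, pathWeight (fun _ => P) u X * (if X i = x then 1 else 0) =
      (P ^ (i : ℕ)) u x := by
  induction L generalizing u with
  | zero =>
    rw [sum_pathWeight_zero, Fin.fin_one_eq_zero i, Fin.val_zero, pow_zero, Matrix.one_apply]
  | succ L ih =>
    rw [sum_pathWeight_succ]
    refine Fin.cases ?_ (fun j => ?_) i
    · simp only [Fin.cons_zero, ← Finset.sum_mul, sum_pathWeight (fun _ => hP), one_mul, hP]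
      simp [Matrix.one_apply]
    · simp only [Fin.cons_succ, ih j]
      rw [Fin.val_succ, pow_succ', Matrix.mul_apply]

/-- The transition matrices of the chain that follows `Z` for `k` steps and `P` afterwards. -/
def resumeAfter (P : Matrix V V ℝ) {L : ℕ} (k : ℕ) (Z : Fin (L + 1) → V) (i : Fin L) :
    Matrix V V ℝ :=
  Matrix.of fun u v => if (i : ℕ) < k then (if v = Z i.succ then 1 else 0) else P u v

omit [Fintype V] in
theorem resumeAfter_apply (P : Matrix V V ℝ) {L : ℕ} (k : ℕ) (Z : Fin (L + 1) → V) (i : Fin L)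
    (u v : V) : resumeAfter P k Z i u v =
      if (i : ℕ) < k then (if v = Z i.succ then 1 else 0) else P u v := rfl

omit [Fintype V] in
theorem resumeAfter_nonneg {P : Matrix V V ℝ} (hP : ∀ u v, 0 ≤ P u v) {L : ℕ} (k : ℕ)
    (Z : Fin (L + 1) → V) (i : Fin L) (u v : V) : 0 ≤ resumeAfter P k Z i u v := by
  rw [resumeAfter_apply]
  split_ifs
  · exact zero_le_one
  · exact le_rfl
  · exact hP u v

theorem resumeAfter_row_sum {P : Matrix V V ℝ} (hP : ∀ u, ∑ v, P u v = 1) {L : ℕ} (k : ℕ)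
    (Z : Fin (L + 1) → V) (i : Fin L) (u : V) : ∑ v, resumeAfter P k Z i u v = 1 := by
  simp only [resumeAfter_apply]
  split_ifs
  · simp
  · exact hP u

/-- The first `k` moves are forced, so the walk is at `Z c` at time `k` and then follows `P`; `c` is
`k` as an index. The induction peels off forced moves and shifts `Z`. -/
theorem sum_pathWeight_resumeAfter_marginal {P : Matrix V V ℝ} (hP : ∀ u, ∑ v, P u v = 1) {L : ℕ}
    (k : ℕ) (Z : Fin (L + 1) → V) (c i : Fin (L + 1)) (hc : (c : ℕ) = k) (hk : k ≤ i) (x : V) :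
    ∑ X : Fin (L + 1) → V, pathWeight (resumeAfter P k Z) (Z 0) X * (if X i = x then 1 else 0) =
      (P ^ ((i : ℕ) - k)) (Z c) x := by
  induction k generalizing L with
  | zero =>
    have h0 : c = 0 := Fin.ext hc
    have : resumeAfter P 0 Z = fun _ => P := by
      funext i u v; rw [resumeAfter_apply, if_neg (Nat.not_lt_zero _)]
    rw [this, h0, Nat.sub_zero, sum_pathWeight_const_marginal hP]
  | succ k ih =>
    cases L with
    | zero => have := i.2; omega
    | succ L =>
      obtain ⟨j, rfl⟩ := Fin.exists_succ_eq.2 (show i ≠ 0 by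
        intro h; rw [h] at hk; simp at hk)
      obtain ⟨d, rfl⟩ := Fin.exists_succ_eq.2 (show c ≠ 0 by
        intro h; rw [h] at hc; simp at hc)
      rw [Fin.val_succ] at hk hc
      rw [sum_pathWeight_succ, Finset.sum_eq_single (Z (Fin.succ 0))]
      · have h1 : (fun i : Fin L => resumeAfter P (k + 1) Z i.succ) =
            resumeAfter P k (fun i => Z i.succ) := by
          funext i u v
          simp [resumeAfter_apply]
        simp only [Fin.cons_succ]
        rw [h1, ih (fun i => Z i.succ) d j (by omega) (by omega)]
        simp [resumeAfter_apply]
      · intro v _ hv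
        have : resumeAfter P (k + 1) Z 0 (Z 0) v = 0 := by
          rw [resumeAfter_apply, if_pos (by simp)]
          exact if_neg hv
        rw [this, zero_mul]
      · intro h; exact absurd (Finset.mem_univ _) h

/-- The joint weight of two paths that share their first `k` steps. -/
def pairWeight (P : Matrix V V ℝ) {L : ℕ} (u : V) (k : ℕ) (X Y : Fin (L + 1) → V) : ℝ :=
  pathWeight (fun _ => P) u X * pathWeight (resumeAfter P k X) (X 0) Y

omit [Fintype V] in
theorem agree_of_pathWeight_resumeAfter_ne_zero {P : Matrix V V ℝ} {L : ℕ} {k : ℕ}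
    {X Y : Fin (L + 1) → V} (h : pathWeight (resumeAfter P k X) (X 0) Y ≠ 0) (i : Fin (L + 1))
    (hi : (i : ℕ) ≤ k) : X i = Y i := by
  rw [pathWeight] at h
  split_ifs at h with h0
  · rcases Fin.eq_zero_or_eq_succ i with rfl | ⟨j, rfl⟩
    · exact h0.symm
    · have := Finset.prod_ne_zero_iff.1 h j (Finset.mem_univ j)
      rw [Fin.val_succ] at hi
      rw [resumeAfter_apply, if_pos (by omega)] at this
      by_contra hne
      exact this (if_neg (Ne.symm hne))
  · exact absurd rfl h

-- Forced moves have weight one, so the common part counts once and the two continuations enter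
-- alike. This form makes the symmetry in the two paths visible.
omit [Fintype V] in
theorem pairWeight_eq_of_agree (P : Matrix V V ℝ) {L : ℕ} (u : V) (k : ℕ) (X Y : Fin (L + 1) → V)
    (h : ∀ i : Fin (L + 1), (i : ℕ) ≤ k → X i = Y i) :
    pairWeight P u k X Y = if X 0 = u then ∏ i : Fin L,
      (if (i : ℕ) < k then P (X i.castSucc) (X i.succ) else
        P (X i.castSucc) (X i.succ) * P (Y i.castSucc) (Y i.succ)) else 0 := by
  rw [pairWeight, pathWeight, pathWeight]
  split_ifs with h1 h2
  · rw [← Finset.prod_mul_distrib]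
    refine Finset.prod_congr rfl fun i _ => ?_
    rw [resumeAfter_apply]
    by_cases hi : (i : ℕ) < k
    · rw [if_pos hi, if_pos hi, if_pos (h i.succ (by rw [Fin.val_succ]; omega)).symm, mul_one]
    · rw [if_neg hi, if_neg hi]
  · exact absurd (h 0 (Nat.zero_le _)).symm h2
  all_goals simp

omit [Fintype V] in
theorem pairWeight_comm (P : Matrix V V ℝ) {L : ℕ} (u : V) (k : ℕ) (X Y : Fin (L + 1) → V) :
    pairWeight P u k X Y = pairWeight P u k Y X := by
  by_cases h : ∀ i : Fin (L + 1), (i : ℕ) ≤ k → X i = Y i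
  · rw [pairWeight_eq_of_agree P u k X Y h,
      pairWeight_eq_of_agree P u k Y X fun i hi => (h i hi).symm, h 0 (Nat.zero_le _)]
    split_ifs
    · refine Finset.prod_congr rfl fun i _ => ?_
      split_ifs with hi
      · rw [h i.castSucc (by rw [Fin.val_castSucc]; omega), h i.succ (by rw [Fin.val_succ]; omega)]
      · rw [mul_comm]
    · rfl
  · have hz : ∀ X Y : Fin (L + 1) → V, (¬ ∀ i : Fin (L + 1), (i : ℕ) ≤ k → X i = Y i) →
        pairWeight P u k X Y = 0 := by
      intro X Y h
      rw [pairWeight]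
      by_contra hne
      exact h (agree_of_pathWeight_resumeAfter_ne_zero (right_ne_zero_of_mul hne))
    rw [hz X Y h, hz Y X fun h' => h fun i hi => (h' i hi).symm]

omit [Fintype V] in
theorem pairWeight_nonneg {P : Matrix V V ℝ} (hP : ∀ u v, 0 ≤ P u v) {L : ℕ} (u : V) (k : ℕ)
    (X Y : Fin (L + 1) → V) : 0 ≤ pairWeight P u k X Y :=
  mul_nonneg (pathWeight_nonneg (fun _ => hP) u X)
    (pathWeight_nonneg (resumeAfter_nonneg hP k X) _ Y)

omit [Fintype V] in
theorem pathWeight_ne_zero {P : Matrix V V ℝ} {L : ℕ} {u : V} {X : Fin (L + 1) → V}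
    (h : pathWeight (fun _ => P) u X ≠ 0) :
    X 0 = u ∧ ∀ i : Fin L, P (X i.castSucc) (X i.succ) ≠ 0 := by
  rw [pathWeight] at h
  split_ifs at h with h0
  · exact ⟨h0, fun i => Finset.prod_ne_zero_iff.1 h i (Finset.mem_univ i)⟩
  · exact absurd rfl h

/-! ### Exponential moments along the block starts -/

/-- The expectation of `∏ i < L, g i (X i)` for the chain started at `u`. -/
def prodExpectation (P : Matrix V V ℝ) : ℕ → (ℕ → V → ℝ) → V → ℝ
  | 0, _, _ => 1
  | L + 1, g, u => g 0 u * ∑ v, P u v * prodExpectation P L (fun i => g (i + 1)) v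

theorem sum_pathWeight_mul_prod (P : Matrix V V ℝ) (L : ℕ) (g : ℕ → V → ℝ) (u : V) :
    ∑ X : Fin (L + 1) → V, pathWeight (fun _ => P) u X * ∏ i : Fin L, g i (X i.castSucc) =
      prodExpectation P L g u := by
  induction L generalizing g u with
  | zero => rw [sum_pathWeight_zero, prodExpectation, Fin.prod_univ_zero]
  | succ L ih =>
    rw [sum_pathWeight_succ, prodExpectation, Finset.mul_sum]
    refine Finset.sum_congr rfl fun v _ => ?_
    rw [← ih (fun i => g (i + 1)) v]
    simp only [Fin.prod_univ_succ, Fin.castSucc_zero, Fin.cons_zero, ← Fin.succ_castSucc,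
      Fin.cons_succ, Fin.val_zero, Fin.val_succ, Finset.mul_sum]
    exact Finset.sum_congr rfl fun _ _ => by ring

/-- Steps with trivial factors merge into a power of `P`, which reduces the walk to its block
starts. -/
theorem prodExpectation_add (P : Matrix V V ℝ) (L s : ℕ) (g : ℕ → V → ℝ)
    (hg : ∀ i < s, ∀ u, g i u = 1) (u : V) :
    prodExpectation P (L + s) g u =
      ∑ y, (P ^ s) u y * prodExpectation P L (fun i => g (i + s)) y := by
  induction s generalizing g u with
  | zero => simp [Matrix.one_apply]
  | succ s ih =>
    rw [← add_assoc, prodExpectation, hg 0 (Nat.succ_pos s), one_mul]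
    simp only [ih (fun i => g (i + 1)) (fun i hi => hg (i + 1) (by omega)), Finset.mul_sum]
    rw [Finset.sum_comm]
    refine Finset.sum_congr rfl fun y _ => ?_
    rw [pow_succ', Matrix.mul_apply, Finset.sum_mul]
    exact Finset.sum_congr rfl fun v _ => by
      simp only [← mul_assoc, add_assoc]

/-- By the Markov property each block start after the first contributes a conditional mean of at
most `1 + m`; the first, at `u`, is not averaged. -/
theorem prodExpectation_block_le {P : Matrix V V ℝ} (τ : ℕ) (hτ : 0 < τ)
    (hP : ∀ u v, 0 ≤ (P ^ τ) u v) (hP1 : ∀ u, ∑ v, (P ^ τ) u v = 1) (h : V → ℝ)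
    (h0 : ∀ u, 0 ≤ h u) (m : ℝ) (hm : ∀ u, ∑ y, (P ^ τ) u y * h y ≤ m) (K : ℕ) (u : V) :
    prodExpectation P (K * τ) (fun i v => if τ ∣ i then 1 + h v else 1) u ≤
      (1 + h u) * (1 + m) ^ K := by
  have hm0 : 0 ≤ m := (Finset.sum_nonneg fun y _ => mul_nonneg (hP u y) (h0 y)).trans (hm u)
  induction K generalizing u with
  | zero => simpa [prodExpectation] using h0 u
  | succ K ih =>
    have hL : (K + 1) * τ = K * τ + (τ - 1) + 1 := by rw [Nat.succ_mul]; omega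
    rw [hL, prodExpectation, if_pos (dvd_zero _)]
    refine mul_le_mul_of_nonneg_left ?_ (by linarith [h0 u])
    have hg : ∀ i < τ - 1, ∀ v : V, (fun i v => if τ ∣ i + 1 then 1 + h v else (1 : ℝ)) i v = 1 :=
      fun i hi v => if_neg fun hd => by have := Nat.le_of_dvd i.succ_pos hd; omega
    simp only [prodExpectation_add P (K * τ) (τ - 1) _ hg]
    have hshift : (fun (i : ℕ) (v : V) => if τ ∣ i + (τ - 1) + 1 then 1 + h v else (1 : ℝ)) =
        fun i v => if τ ∣ i then 1 + h v else 1 := by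
      funext i v
      have : i + (τ - 1) + 1 = i + τ := by omega
      simp only [this, Nat.dvd_add_self_right]
    rw [hshift]
    have heq : ∑ v, P u v * ∑ y, (P ^ (τ - 1)) v y *
        prodExpectation P (K * τ) (fun i v => if τ ∣ i then 1 + h v else 1) y =
        ∑ y, (P ^ τ) u y *
          prodExpectation P (K * τ) (fun i v => if τ ∣ i then 1 + h v else 1) y := by
      simp only [Finset.mul_sum]
      rw [Finset.sum_comm]
      refine Finset.sum_congr rfl fun y _ => ?_
      have : P ^ τ = P * P ^ (τ - 1) := by
        rw [← pow_succ', Nat.sub_add_cancel hτ]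
      rw [this, Matrix.mul_apply, Finset.sum_mul]
      exact Finset.sum_congr rfl fun v _ => by rw [mul_assoc]
    rw [heq]
    calc _ ≤ ∑ y, (P ^ τ) u y * ((1 + h y) * (1 + m) ^ K) :=
          Finset.sum_le_sum fun y _ => mul_le_mul_of_nonneg_left (ih y) (hP u y)
      _ = (1 + ∑ y, (P ^ τ) u y * h y) * (1 + m) ^ K := by
          have : (1 : ℝ) + ∑ y, (P ^ τ) u y * h y = ∑ y, (P ^ τ) u y * (1 + h y) := by
            simp only [mul_add, mul_one, Finset.sum_add_distrib, hP1]
          rw [this, Finset.sum_mul]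
          exact Finset.sum_congr rfl fun y _ => by ring
      _ ≤ (1 + m) * (1 + m) ^ K :=
          mul_le_mul_of_nonneg_right (by linarith [hm u]) (by positivity)
      _ = (1 + m) ^ (K + 1) := by ring

/-- The time at which the `k`-th block of length `τ` starts. -/
def blockStart {K τ : ℕ} [NeZero τ] (k : Fin K) : Fin (K * τ) := finProdFinEquiv (k, 0)

theorem val_blockStart {K τ : ℕ} [NeZero τ] (k : Fin K) :
    ((blockStart k : Fin (K * τ)) : ℕ) = τ * k := by
  simp [blockStart]

omit [Fintype V] [DecidableEq V] in
theorem prod_block {K τ : ℕ} [NeZero τ] (h : V → ℝ) (X : Fin (K * τ + 1) → V) :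
    ∏ i : Fin (K * τ), (if τ ∣ (i : ℕ) then 1 + h (X i.castSucc) else 1) =
      ∏ k : Fin K, (1 + h (X (blockStart (τ := τ) k).castSucc)) := by
  rw [← finProdFinEquiv.prod_comp, Fintype.prod_prod_type]
  refine Finset.prod_congr rfl fun k _ => ?_
  rw [Finset.prod_eq_single 0]
  · rw [if_pos]
    · rfl
    · simp
  · intro b _ hb
    rw [if_neg]
    rw [finProdFinEquiv_apply_val, Nat.dvd_add_left (dvd_mul_right _ _)]
    intro hd
    refine hb (Fin.ext ?_)
    rw [Fin.val_zero]
    exact Nat.eq_zero_of_dvd_of_lt hd b.2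
  · intro hh; exact absurd (Finset.mem_univ _) hh

/-- A vertex chosen with knowledge of the path is rarely close to many block starts. -/
theorem sum_pathWeight_mul_sum_le {P : Matrix V V ℝ} (hP : ∀ u v, 0 ≤ P u v)
    (hP1 : ∀ u, ∑ v, P u v = 1) {K τ : ℕ} [NeZero τ] (hPτ : ∀ u v, 0 ≤ (P ^ τ) u v)
    (hPτ1 : ∀ u, ∑ v, (P ^ τ) u v = 1) (h : V → V → ℝ)
    (h0 : ∀ u x, 0 ≤ h u x) (h1 : ∀ u x, h u x ≤ 1) (m : ℝ)
    (hm : ∀ u x, ∑ y, (P ^ τ) u y * h y x ≤ m) (u : V) (ξ : (Fin (K * τ + 1) → V) → V) :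
    ∑ X, pathWeight (fun _ => P) u X *
        ∑ k : Fin K, h (X (blockStart (τ := τ) k).castSucc) (ξ X) ≤
      (Real.log (2 * Fintype.card V) + m * K) / Real.log 2 := by
  set p : (Fin (K * τ + 1) → V) → ℝ := pathWeight (fun _ => P) u with hp
  set S : (Fin (K * τ + 1) → V) → V → ℝ := fun X x =>
    ∑ k : Fin K, h (X (blockStart (τ := τ) k).castSucc) x with hS
  have hp0 : ∀ X, 0 ≤ p X := pathWeight_nonneg (fun _ => hP) u
  have hp1 : ∑ X, p X = 1 := sum_pathWeight (fun _ => hP1) u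
  have hm0 : 0 ≤ m :=
    (Finset.sum_nonneg fun y _ => mul_nonneg (hPτ u y) (h0 y u)).trans (hm u u)
  have hcard : (0 : ℝ) < Fintype.card V := by
    have : 0 < Fintype.card V := Fintype.card_pos_iff.2 ⟨u⟩
    exact_mod_cast this
  -- For `h` in `[0, 1]` one has `2 ^ h ≤ 1 + h`, so the exponential moment is bounded by a product
  -- over block starts.
  have hexp : ∀ x, ∑ X, p X * Real.exp (S X x * Real.log 2) ≤ 2 * Real.exp (m * K) := by
    intro x
    calc ∑ X, p X * Real.exp (S X x * Real.log 2)
        ≤ ∑ X, p X * ∏ i : Fin (K * τ),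
          (if τ ∣ (i : ℕ) then 1 + h (X i.castSucc) x else 1) := by
          refine Finset.sum_le_sum fun X _ => mul_le_mul_of_nonneg_left ?_ (hp0 X)
          rw [prod_block (fun v => h v x), hS, Finset.sum_mul, Real.exp_sum]
          refine Finset.prod_le_prod (fun _ _ => (Real.exp_pos _).le) fun k _ => ?_
          have := rpow_one_add_le_one_add_mul_self (s := 1) (by norm_num)
            (h0 (X (blockStart (τ := τ) k).castSucc) x) (h1 _ x)
          rw [Real.rpow_def_of_pos (by norm_num), mul_one] at this
          rw [mul_comm]
          norm_num at this
          exact this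
      _ = prodExpectation P (K * τ) (fun i v => if τ ∣ i then 1 + h v x else 1) u :=
          sum_pathWeight_mul_prod P (K * τ) (fun i v => if τ ∣ i then 1 + h v x else 1) u
      _ ≤ (1 + h u x) * (1 + m) ^ K :=
          prodExpectation_block_le τ (NeZero.pos τ) hPτ hPτ1 (fun v => h v x) (fun v => h0 v x) m
            (fun v => hm v x) K u
      _ ≤ 2 * Real.exp (m * K) := by
          have h2 : (1 + m) ^ K ≤ Real.exp (m * K) := by
            rw [mul_comm, Real.exp_nat_mul]
            exact pow_le_pow_left₀ (by linarith) (by linarith [Real.add_one_le_exp m]) K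
          exact mul_le_mul (by linarith [h1 u x]) h2 (by positivity) (by norm_num)
  set B : ℝ := 2 * Fintype.card V * Real.exp (m * K) with hB
  have hBpos : 0 < B := by positivity
  have hlogB : Real.log B = Real.log (2 * Fintype.card V) + m * K := by
    rw [hB, Real.log_mul (by positivity) (Real.exp_pos _).ne', Real.log_exp]
  -- The choice of `ξ X` may depend on the whole path; summing over all vertices removes this
  -- dependence at the cost of a factor `card V`.
  have hmax : ∑ X, p X * Real.exp (S X (ξ X) * Real.log 2) ≤ B := by
    calc ∑ X, p X * Real.exp (S X (ξ X) * Real.log 2)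
        ≤ ∑ X, ∑ x, p X * Real.exp (S X x * Real.log 2) :=
          Finset.sum_le_sum fun X _ => Finset.single_le_sum
            (f := fun x => p X * Real.exp (S X x * Real.log 2))
            (fun x _ => mul_nonneg (hp0 X) (Real.exp_pos _).le) (Finset.mem_univ (ξ X))
      _ = ∑ x, ∑ X, p X * Real.exp (S X x * Real.log 2) := Finset.sum_comm
      _ ≤ ∑ _x : V, 2 * Real.exp (m * K) := Finset.sum_le_sum fun x _ => hexp x
      _ = B := by rw [Finset.sum_const, Finset.card_univ, nsmul_eq_mul, hB]; ring
  -- The tangent to `exp` at `log B`; averaging it plays the role of Jensen's inequality.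
  have htan : ∀ s : ℝ, B * (1 + s - Real.log B) ≤ Real.exp s := by
    intro s
    have := Real.add_one_le_exp (s - Real.log B)
    rw [Real.exp_sub, Real.exp_log hBpos, le_div_iff₀ hBpos] at this
    linarith
  have hlin : B * (1 + (∑ X, p X * S X (ξ X)) * Real.log 2 - Real.log B) ≤ B := by
    refine le_trans (le_of_eq ?_) ((Finset.sum_le_sum fun X _ =>
      mul_le_mul_of_nonneg_left (htan (S X (ξ X) * Real.log 2)) (hp0 X)).trans hmax)
    have : ∀ X, p X * (B * (1 + S X (ξ X) * Real.log 2 - Real.log B)) =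
        p X * (B * (1 - Real.log B)) + p X * S X (ξ X) * (B * Real.log 2) := fun X => by ring
    simp only [this]
    rw [Finset.sum_add_distrib, ← Finset.sum_mul, ← Finset.sum_mul, hp1]
    ring
  rw [le_div_iff₀ (Real.log_pos (by norm_num)), ← hlogB]
  have := le_of_mul_le_mul_left (a := B) (b := 1 + (∑ X, p X * S X (ξ X)) * Real.log 2 -
    Real.log B) (c := 1) (by rw [mul_one]; exact hlin) hBpos
  linarith

end Paths

end LocalSearch

namespace LocalSearch

/-! ### Functions that decrease along a path -/

section PathFunction

variable {V : Type*} [DecidableEq V]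

/-- The last time at which the path visits `v`. -/
def lastVisit {L : ℕ} (X : Fin (L + 1) → V) (v : V) : ℕ :=
  (Finset.univ.filter fun i => X i = v).sup fun i => (i : ℕ)

theorem le_lastVisit {L : ℕ} (X : Fin (L + 1) → V) (i : Fin (L + 1)) :
    (i : ℕ) ≤ lastVisit X (X i) :=
  Finset.le_sup (f := fun i : Fin (L + 1) => (i : ℕ)) (by simp)

theorem exists_eq_lastVisit {L : ℕ} (X : Fin (L + 1) → V) {v : V} (h : ∃ i, X i = v) :
    ∃ i, X i = v ∧ lastVisit X v = (i : ℕ) := by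
  obtain ⟨j, hj⟩ := h
  obtain ⟨i, hi, he⟩ := Finset.exists_mem_eq_sup (Finset.univ.filter fun i => X i = v)
    ⟨j, by simpa using hj⟩ (fun i => (i : ℕ))
  exact ⟨i, by simpa using hi, he⟩

open Classical in
/-- The function that decreases along the path `X`, in the order of the last visits, and is the
distance to the start of `X` elsewhere. -/
noncomputable def pathFunction (G : SimpleGraph V) {L : ℕ} (X : Fin (L + 1) → V) (v : V) : ℝ :=
  if ∃ i, X i = v then -(lastVisit X v : ℝ) else G.dist (X 0) v

omit [DecidableEq V] in
theorem _root_.SimpleGraph.Connected.exists_adj_dist_lt {G : SimpleGraph V} (hG : G.Connected)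
    {u v : V} (h : v ≠ u) : ∃ w, G.Adj v w ∧ G.dist u w < G.dist u v := by
  obtain ⟨p, hp⟩ := hG.exists_walk_length_eq_dist v u
  cases p with
  | nil => exact absurd rfl h
  | cons hadj q =>
    refine ⟨_, hadj, ?_⟩
    rw [SimpleGraph.dist_comm, SimpleGraph.dist_comm (u := u), ← hp, SimpleGraph.Walk.length_cons]
    exact Nat.lt_succ_of_le (SimpleGraph.dist_le q)

/-- The last vertex of the path is the only local minimum of its path function. -/
theorem eq_last_of_isLocalMinimum {G : SimpleGraph V} (hG : G.Connected) {L : ℕ}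
    (X : Fin (L + 1) → V)
    (hX : ∀ i : Fin L, X i.castSucc ≠ X i.succ → G.Adj (X i.castSucc) (X i.succ)) {v : V}
    (hv : IsLocalMinimum G (pathFunction G X) v) : v = X (Fin.last L) := by
  by_cases h : ∃ i, X i = v
  -- After its last visit to `v` the path moves to a neighbour that is last visited later, hence has
  -- a smaller value.
  · obtain ⟨i, hi, hlast⟩ := exists_eq_lastVisit X h
    rcases Fin.eq_castSucc_or_eq_last i with ⟨j, rfl⟩ | rfl
    · exfalso
      have hle := le_lastVisit X j.succ
      have hne : X j.castSucc ≠ X j.succ := by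
        intro he
        rw [← he, hi, hlast, Fin.val_succ, Fin.val_castSucc] at hle
        omega
      have hmin := hv (X j.succ) (hi ▸ hX j hne)
      rw [pathFunction, pathFunction, if_pos h, if_pos ⟨_, rfl⟩, hlast, neg_le_neg_iff,
        Nat.cast_le] at hmin
      rw [Fin.val_succ] at hle
      rw [Fin.val_castSucc] at hmin
      omega
    · exact hi.symm
  -- Off the path, a neighbour nearer to `X 0` has a smaller distance, or lies on the path and has a
  -- nonpositive value.
  · exfalso
    have hne : v ≠ X 0 := fun he => h ⟨0, he.symm⟩
    obtain ⟨w, hadj, hlt⟩ := hG.exists_adj_dist_lt hne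
    have hmin := hv w hadj
    rw [pathFunction, if_neg h, pathFunction] at hmin
    split_ifs at hmin
    · have h1 : (0 : ℝ) < G.dist (X 0) v := by exact_mod_cast (Nat.zero_le _).trans_lt hlt
      have h2 : (0 : ℝ) ≤ lastVisit X w := Nat.cast_nonneg _
      linarith
    · exact absurd (Nat.cast_le.1 hmin) (not_le.2 hlt)

/-- The value at `v` depends only on the start and on the times at which `v` is visited. -/
theorem pathFunction_congr (G : SimpleGraph V) {L : ℕ} (X Y : Fin (L + 1) → V) (k : ℕ)
    (h : ∀ i : Fin (L + 1), (i : ℕ) ≤ k → X i = Y i) (v : V)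
    (hX : ∀ i : Fin (L + 1), k < i → X i ≠ v) (hY : ∀ i : Fin (L + 1), k < i → Y i ≠ v) :
    pathFunction G X v = pathFunction G Y v := by
  have hiff : ∀ i, X i = v ↔ Y i = v := by
    intro i
    rcases le_or_gt (i : ℕ) k with hi | hi
    · rw [h i hi]
    · exact iff_of_false (hX i hi) (hY i hi)
  simp only [pathFunction, lastVisit, hiff, h 0 (Nat.zero_le _)]

end PathFunction

/-! ### The adversary bound for random walks -/

section Adversary

variable {n : ℕ} {G : SimpleGraph (Fin n)} {P : Matrix (Fin n) (Fin n) ℝ}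

/-- A bound for the probability to reach `x` from `u` within `1, …, τ` steps. -/
noncomputable def hitBound (P : Matrix (Fin n) (Fin n) ℝ) (τ : ℕ) (u x : Fin n) : ℝ :=
  min 1 (∑ s ∈ Finset.Icc 1 τ, (P ^ s) u x)

-- Visits within `τ` steps of the branching time `c` are covered by `hitBound`; each of the at most
-- `L + 1` later times has probability at most `q`.
open Classical in
theorem sum_resumeAfter_visit_le (hP : IsChainOn G P) (τ : ℕ) (q : ℝ)
    (hq : ∀ s, τ ≤ s → ∀ u x, (P ^ s) u x ≤ q) {L : ℕ} (c : Fin (L + 1))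
    (X : Fin (L + 1) → Fin n) (x : Fin n) :
    ∑ Y : Fin (L + 1) → Fin n, pathWeight (resumeAfter P c X) (X 0) Y *
        (if ∃ i : Fin (L + 1), (c : ℕ) < i ∧ Y i = x then 1 else 0) ≤
      hitBound P τ (X c) x + (L + 1) * q := by
  set p := fun Y : Fin (L + 1) → Fin n => pathWeight (resumeAfter P c X) (X 0) Y with hp
  have hp0 : ∀ Y, 0 ≤ p Y := pathWeight_nonneg (resumeAfter_nonneg hP.nonneg c X) _
  have hp1 : ∑ Y, p Y = 1 := sum_pathWeight (resumeAfter_row_sum hP.row_sum c X) _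
  have hmarg : ∀ i : Fin (L + 1), (c : ℕ) ≤ i →
      ∑ Y, p Y * (if Y i = x then 1 else 0) = (P ^ ((i : ℕ) - c)) (X c) x := fun i hi =>
    sum_pathWeight_resumeAfter_marginal hP.row_sum c X c i rfl hi x
  have hq0 : 0 ≤ q := (hP.pow_nonneg τ x x).trans (hq τ le_rfl x x)
  set near := Finset.univ.filter fun i : Fin (L + 1) => (c : ℕ) < i ∧ (i : ℕ) ≤ c + τ with hnear
  set far := Finset.univ.filter fun i : Fin (L + 1) => (c : ℕ) + τ < i with hfar
  have hI0 : ∀ (Y : Fin (L + 1) → Fin n) i, (0 : ℝ) ≤ if Y i = x then 1 else 0 := fun Y i => by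
    split_ifs <;> norm_num
  have hpt : ∀ Y : Fin (L + 1) → Fin n,
      (if ∃ i : Fin (L + 1), (c : ℕ) < i ∧ Y i = x then (1 : ℝ) else 0) ≤
      (if ∃ i ∈ near, Y i = x then 1 else 0) + ∑ i ∈ far, if Y i = x then 1 else 0 := by
    intro Y
    have hs : (0 : ℝ) ≤ ∑ i ∈ far, if Y i = x then 1 else 0 :=
      Finset.sum_nonneg fun i _ => hI0 Y i
    by_cases h1 : ∃ i : Fin (L + 1), (c : ℕ) < i ∧ Y i = x
    · rw [if_pos h1]
      by_cases h2 : ∃ i ∈ near, Y i = x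
      · rw [if_pos h2]; linarith
      · obtain ⟨i, hi, hx⟩ := h1
        have hif : i ∈ far := by
          by_contra hni
          refine h2 ⟨i, ?_, hx⟩
          simp only [hfar, hnear, Finset.mem_filter, Finset.mem_univ, true_and, not_lt] at hni ⊢
          exact ⟨hi, hni⟩
        have := Finset.single_le_sum (fun i _ => hI0 Y i) hif
        rw [if_pos hx] at this
        rw [if_neg h2]; linarith
    · rw [if_neg h1]
      split_ifs <;> linarith
  have hnear1 : ∑ Y, p Y * (if ∃ i ∈ near, Y i = x then (1 : ℝ) else 0) ≤ hitBound P τ (X c) x := by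
    refine le_min ?_ ?_
    · refine le_of_le_of_eq (Finset.sum_le_sum fun Y _ => ?_) hp1
      have := hp0 Y
      split_ifs <;> linarith
    · calc ∑ Y, p Y * (if ∃ i ∈ near, Y i = x then (1 : ℝ) else 0)
          ≤ ∑ Y, p Y * ∑ i ∈ near, (if Y i = x then (1 : ℝ) else 0) := by
            refine Finset.sum_le_sum fun Y _ => mul_le_mul_of_nonneg_left ?_ (hp0 Y)
            split_ifs with h2
            · obtain ⟨i, hi, hx⟩ := h2
              have := Finset.single_le_sum (fun i _ => hI0 Y i) hi
              rwa [if_pos hx] at this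
            · exact Finset.sum_nonneg fun i _ => hI0 Y i
        _ = ∑ i ∈ near, (P ^ ((i : ℕ) - c)) (X c) x := by
            simp only [Finset.mul_sum]
            rw [Finset.sum_comm]
            refine Finset.sum_congr rfl fun i hi => hmarg i ?_
            simp only [hnear, Finset.mem_filter, Finset.mem_univ, true_and] at hi
            exact hi.1.le
        _ = ∑ s ∈ near.image (fun i : Fin (L + 1) => (i : ℕ) - c), (P ^ s) (X c) x := by
            rw [Finset.sum_image]
            intro i hi j hj hij
            simp only [hnear, Finset.coe_filter, Finset.mem_univ, true_and,
              Set.mem_ofPred_eq] at hi hj hij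
            exact Fin.ext (by omega)
        _ ≤ ∑ s ∈ Finset.Icc 1 τ, (P ^ s) (X c) x := by
            refine Finset.sum_le_sum_of_subset_of_nonneg ?_ fun s _ _ => hP.pow_nonneg s _ _
            intro s hs
            simp only [hnear, Finset.mem_image, Finset.mem_filter, Finset.mem_univ,
              true_and] at hs
            obtain ⟨i, hi, rfl⟩ := hs
            rw [Finset.mem_Icc]
            omega
  have hfar1 : ∑ Y, p Y * ∑ i ∈ far, (if Y i = x then (1 : ℝ) else 0) ≤ (L + 1) * q := by
    simp only [Finset.mul_sum]
    rw [Finset.sum_comm]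
    calc _ ≤ ∑ _i ∈ far, q := by
          refine Finset.sum_le_sum fun i hi => ?_
          simp only [hfar, Finset.mem_filter, Finset.mem_univ, true_and] at hi
          rw [hmarg i (by omega)]
          exact hq _ (by omega) _ _
      _ ≤ ∑ _i : Fin (L + 1), q :=
          Finset.sum_le_sum_of_subset_of_nonneg (Finset.subset_univ _) fun _ _ _ => hq0
      _ = (L + 1) * q := by simp
  calc _ ≤ ∑ Y, p Y * ((if ∃ i ∈ near, Y i = x then 1 else 0) +
        ∑ i ∈ far, if Y i = x then 1 else 0) :=
        Finset.sum_le_sum fun Y _ => mul_le_mul_of_nonneg_left (hpt Y) (hp0 Y)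
    _ ≤ _ := by
        simp only [mul_add, Finset.sum_add_distrib]
        exact add_le_add hnear1 hfar1

open Classical in
/-- A vertex chosen with knowledge of one path rarely lies on the fresh part of the other. -/
theorem sum_pairWeight_visit_le (hP : IsChainOn G P) {K τ : ℕ} [NeZero τ] (q σ : ℝ)
    (hq : ∀ s, τ ≤ s → ∀ u x, (P ^ s) u x ≤ q) (hσ : ∀ s x, ∑ y, (P ^ s) y x ≤ σ)
    (u : Fin n) (ξ : (Fin (K * τ + 1) → Fin n) → Fin n) :
    ∑ k : Fin K, ∑ X : Fin (K * τ + 1) → Fin n, ∑ Y : Fin (K * τ + 1) → Fin n,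
        pairWeight P u (τ * k) X Y *
          (if ∃ i : Fin (K * τ + 1), τ * (k : ℕ) < i ∧ Y i = ξ X then 1 else 0) ≤
      (Real.log (2 * n) + q * (τ * σ) * K) / Real.log 2 + K * ((K * τ + 1) * q) := by
  have hq0 : 0 ≤ q := (hP.pow_nonneg τ u u).trans (hq τ le_rfl u u)
  have hinner : ∀ (k : Fin K) (X : Fin (K * τ + 1) → Fin n),
      ∑ Y : Fin (K * τ + 1) → Fin n, pairWeight P u (τ * k) X Y *
          (if ∃ i : Fin (K * τ + 1), τ * (k : ℕ) < i ∧ Y i = ξ X then 1 else 0) ≤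
      pathWeight (fun _ => P) u X * (hitBound P τ (X (blockStart (τ := τ) k).castSucc) (ξ X) +
        (K * τ + 1) * q) := by
    intro k X
    have h := sum_resumeAfter_visit_le hP τ q hq (blockStart (τ := τ) k).castSucc X (ξ X)
    rw [Fin.val_castSucc, val_blockStart, Nat.cast_mul] at h
    refine le_trans (le_of_eq ?_) (mul_le_mul_of_nonneg_left h
      (pathWeight_nonneg (fun _ => hP.nonneg) u X))
    simp only [pairWeight, Finset.mul_sum, mul_assoc]
  -- The cap at one in `hitBound` provides `h ≤ 1`. The mean `q * (τ * σ)` arises because a block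
  -- spreads the walk to density `q`, while each of the `τ` column sums is at most `σ`.
  have hmoment := sum_pathWeight_mul_sum_le hP.nonneg hP.row_sum (K := K) (hP.pow_nonneg τ)
    (hP.pow_row_sum τ) (hitBound P τ)
    (fun u x => le_min zero_le_one (Finset.sum_nonneg fun s _ => hP.pow_nonneg s u x))
    (fun u x => min_le_left _ _) (q * (τ * σ))
    (by
      intro u x
      calc ∑ y, (P ^ τ) u y * hitBound P τ y x
          ≤ ∑ y, q * ∑ s ∈ Finset.Icc 1 τ, (P ^ s) y x :=
            Finset.sum_le_sum fun y _ => mul_le_mul (hq τ le_rfl u y) (min_le_right _ _)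
              (le_min zero_le_one (Finset.sum_nonneg fun s _ => hP.pow_nonneg s y x)) hq0
        _ = q * ∑ s ∈ Finset.Icc 1 τ, ∑ y, (P ^ s) y x := by
            rw [← Finset.mul_sum, Finset.sum_comm]
        _ ≤ q * ∑ _s ∈ Finset.Icc 1 τ, σ :=
            mul_le_mul_of_nonneg_left (Finset.sum_le_sum fun s _ => hσ s x) hq0
        _ = q * (τ * σ) := by simp) u ξ
  rw [Fintype.card_fin] at hmoment
  calc _ ≤ ∑ k : Fin K, ∑ X : Fin (K * τ + 1) → Fin n, pathWeight (fun _ => P) u X *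
        (hitBound P τ (X (blockStart (τ := τ) k).castSucc) (ξ X) + (K * τ + 1) * q) :=
        Finset.sum_le_sum fun k _ => Finset.sum_le_sum fun X _ => hinner k X
    _ = ∑ X : Fin (K * τ + 1) → Fin n, pathWeight (fun _ => P) u X *
        ∑ k : Fin K, hitBound P τ (X (blockStart (τ := τ) k).castSucc) (ξ X) +
        K * ((K * τ + 1) * q) := by
        simp only [mul_add, Finset.sum_add_distrib, ← Finset.sum_mul,
          sum_pathWeight (fun _ => hP.row_sum), Finset.mul_sum]
        rw [Finset.sum_comm]
        simp
    _ ≤ _ := by linarith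

/-- The lower bound obtained from `K` blocks of `τ` steps of the chain. -/
theorem le_randomizedQueryComplexity_of_chain (hG : G.Connected) (hP : IsChainOn G P) {K τ : ℕ}
    [NeZero τ] [NeZero K] (q σ : ℝ) (hq : ∀ s, τ ≤ s → ∀ u x, (P ^ s) u x ≤ q)
    (hσ : ∀ s x, ∑ y, (P ^ s) y x ≤ σ) (u : Fin n) (T : ℕ) (γ : ℝ)
    (hγ : 2 / K * ((Real.log (2 * n) + q * (τ * σ) * K) / Real.log 2 + K * ((K * τ + 1) * q)) ≤ γ) :
    ENNReal.ofReal ((T + 1) * (4 / 5 - q - T * γ) / 2) ≤ randomizedQueryComplexity G := by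
  classical
  have hK : (0 : ℝ) < K := Nat.cast_pos.2 (NeZero.pos K)
  let Path := Fin (K * τ + 1) → Fin n
  let w : Fin K × Path × Path → ℝ := fun j => 1 / K * pairWeight P u (τ * j.1) j.2.1 j.2.2
  have hw : ∀ j, 0 ≤ w j := fun j =>
    mul_nonneg (by positivity) (pairWeight_nonneg hP.nonneg u _ _ _)
  have hdecomp : ∀ φ : Fin K → Path → Path → ℝ, ∑ j : Fin K × Path × Path, w j * φ j.1 j.2.1 j.2.2 =
      1 / K * ∑ k : Fin K, ∑ X : Path, ∑ Y : Path, pairWeight P u (τ * k) X Y * φ k X Y := by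
    intro φ
    simp only [Fintype.sum_prod_type, Finset.mul_sum, w, mul_assoc]
  have hsum1 : ∀ k X, ∑ Y : Path, pairWeight P u k X Y = pathWeight (fun _ => P) u X := by
    intro k X
    simp only [pairWeight]
    rw [← Finset.mul_sum, sum_pathWeight (resumeAfter_row_sum hP.row_sum k X), mul_one]
  have hw1 : ∑ j, w j = 1 := by
    have := hdecomp fun _ _ _ => 1
    simp only [mul_one, hsum1] at this
    rw [this]
    simp only [Path, sum_pathWeight (fun _ => hP.row_sum)]
    simp [hK.ne']
  have hvalid : ∀ {k} {X Y : Path}, pairWeight P u k X Y ≠ 0 →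
      ∀ i : Fin (K * τ), X i.castSucc ≠ X i.succ → G.Adj (X i.castSucc) (X i.succ) := by
    intro k X Y h i hne
    by_contra hadj
    exact (pathWeight_ne_zero (left_ne_zero_of_mul h)).2 i (hP.eq_zero _ _ hne hadj)
  refine le_randomizedQueryComplexity G w hw hw1 (fun j => pathFunction G j.2.1)
    (fun j => pathFunction G j.2.2) γ q ?_ ?_ T
  -- A common local minimum forces equal endpoints. At least `τ` independent steps follow the
  -- branching, so this has probability at most `q`.
  · have hle : ∀ j : Fin K × Path × Path,
        (if ∃ v, IsLocalMinimum G (pathFunction G j.2.1) v ∧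
          IsLocalMinimum G (pathFunction G j.2.2) v then w j else 0) ≤
        w j * (if j.2.2 (Fin.last _) = j.2.1 (Fin.last _) then 1 else 0) := by
      rintro ⟨k, X, Y⟩
      by_cases h0 : pairWeight P u (τ * k) X Y = 0
      · have : w (k, X, Y) = 0 := by simp only [w, h0, mul_zero]
        simp [this]
      · split_ifs with h1 h2 h2
        · rw [mul_one]
        · obtain ⟨v, hv1, hv2⟩ := h1
          refine absurd (show Y (Fin.last _) = X (Fin.last _) from ?_) h2
          rw [← eq_last_of_isLocalMinimum hG X (hvalid h0) hv1]
          rw [pairWeight_comm] at h0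
          rw [← eq_last_of_isLocalMinimum hG Y (hvalid h0) hv2]
        · rw [mul_one]; exact hw _
        · rw [mul_zero]
    refine (Finset.sum_le_sum fun j _ => le_of_eq_of_le (by congr) (hle j)).trans ?_
    rw [hdecomp fun _ X Y => if Y (Fin.last _) = X (Fin.last _) then 1 else 0]
    have hk : ∀ k : Fin K, ∑ X : Path, ∑ Y : Path, pairWeight P u (τ * k) X Y *
        (if Y (Fin.last _) = X (Fin.last _) then 1 else 0) ≤ q := by
      intro k
      have hkl : τ * (k : ℕ) + τ ≤ K * τ := by
        rw [mul_comm K, ← Nat.mul_succ]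
        exact Nat.mul_le_mul_left τ k.2
      calc _ ≤ ∑ X : Path, pathWeight (fun _ => P) u X * q := by
            refine Finset.sum_le_sum fun X _ => ?_
            simp only [pairWeight, mul_assoc, ← Finset.mul_sum]
            refine mul_le_mul_of_nonneg_left ?_ (pathWeight_nonneg (fun _ => hP.nonneg) u X)
            rw [sum_pathWeight_resumeAfter_marginal hP.row_sum (τ * k) X
              (blockStart (τ := τ) k).castSucc (Fin.last _)
              (by rw [Fin.val_castSucc, val_blockStart]) (by rw [Fin.val_last]; omega)]
            exact hq _ (by rw [Fin.val_last]; omega) _ _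
        _ = q := by rw [← Finset.sum_mul, sum_pathWeight (fun _ => hP.row_sum), one_mul]
    calc _ ≤ 1 / (K : ℝ) * ∑ _k : Fin K, q :=
          mul_le_mul_of_nonneg_left (Finset.sum_le_sum fun k _ => hk k) (by positivity)
      _ = q := by simp [hK.ne']
  · intro x
    let I : Fin K → Path → Path → ℝ := fun k X Y =>
      if ∃ i : Fin (K * τ + 1), τ * (k : ℕ) < i ∧ Y i = x (pathFunction G X) then 1 else 0
    have hI0 : ∀ k X Y, 0 ≤ I k X Y := fun k X Y => by
      simp only [I]; split_ifs <;> norm_num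
    -- If the values differ, the queried vertex is visited by `X` or `Y` after branching. Since both
    -- inputs query the same vertex, it can be named through the other path.
    have hle : ∀ j : Fin K × Path × Path,
        (if x (pathFunction G j.2.1) = x (pathFunction G j.2.2) ∧
          pathFunction G j.2.1 (x (pathFunction G j.2.1)) ≠
            pathFunction G j.2.2 (x (pathFunction G j.2.1)) then w j else 0) ≤
        w j * (I j.1 j.2.1 j.2.2 + I j.1 j.2.2 j.2.1) := by
      rintro ⟨k, X, Y⟩
      have hnn : 0 ≤ w (k, X, Y) * (I k X Y + I k Y X) :=
        mul_nonneg (hw _) (add_nonneg (hI0 _ _ _) (hI0 _ _ _))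
      split_ifs with h
      swap
      · exact hnn
      by_cases h0 : pairWeight P u (τ * k) X Y = 0
      · have : w (k, X, Y) = 0 := by simp only [w, h0, mul_zero]
        rw [this, zero_mul]
      · refine le_mul_of_one_le_right (hw _) ?_
        obtain ⟨h1, h2⟩ := h
        by_cases hY : ∃ i : Fin (K * τ + 1), τ * (k : ℕ) < i ∧ Y i = x (pathFunction G X)
        · have : I k X Y = 1 := if_pos hY
          linarith [hI0 k Y X]
        by_cases hX : ∃ i : Fin (K * τ + 1), τ * (k : ℕ) < i ∧ X i = x (pathFunction G Y)
        · have : I k Y X = 1 := if_pos hX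
          linarith [hI0 k X Y]
        refine absurd (pathFunction_congr G X Y (τ * k)
          (agree_of_pathWeight_resumeAfter_ne_zero (right_ne_zero_of_mul h0)) _ ?_ ?_) h2
        · intro i hi he
          exact hX ⟨i, hi, he.trans h1⟩
        · intro i hi he
          exact hY ⟨i, hi, he⟩
    refine (Finset.sum_le_sum fun j _ => le_of_eq_of_le (by congr) (hle j)).trans ?_
    rw [hdecomp fun k X Y => I k X Y + I k Y X]
    have hone := sum_pairWeight_visit_le hP (K := K) q σ hq hσ u fun X => x (pathFunction G X)
    -- Exchangeability of the pair makes the two cases equal, whence the factor `2 / K`.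
    have hsymm : ∑ k : Fin K, ∑ X : Path, ∑ Y : Path, pairWeight P u (τ * k) X Y * I k Y X =
        ∑ k : Fin K, ∑ X : Path, ∑ Y : Path, pairWeight P u (τ * k) X Y * I k X Y := by
      refine Finset.sum_congr rfl fun k _ => ?_
      rw [Finset.sum_comm]
      refine Finset.sum_congr rfl fun X _ => Finset.sum_congr rfl fun Y _ => ?_
      rw [pairWeight_comm]
    simp only [mul_add (pairWeight _ _ _ _ _), Finset.sum_add_distrib]
    rw [hsymm]
    refine le_trans ?_ hγ
    calc _ = 2 / (K : ℝ) *
          ∑ k : Fin K, ∑ X : Path, ∑ Y : Path, pairWeight P u (τ * k) X Y * I k X Y := by ring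
      _ ≤ _ := mul_le_mul_of_nonneg_left hone (by positivity)

/-- Two different vertices already force a constant number of queries. -/
theorem le_randomizedQueryComplexity_of_ne (hG : G.Connected) {u v : Fin n} (huv : u ≠ v) :
    ENNReal.ofReal (2 / 5) ≤ randomizedQueryComplexity G := by
  have hloc : ∀ a b : Fin n, IsLocalMinimum G (fun y => (G.dist a y : ℝ)) b → b = a := by
    intro a b h
    by_contra hne
    obtain ⟨w, hadj, hlt⟩ := hG.exists_adj_dist_lt hne
    exact absurd (Nat.cast_le.1 (h w hadj)) (not_le.2 hlt)
  -- The distances to `u` and to `v` have no common local minimum. With `T = 0` the value of `γ`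
  -- plays no role and the bound is `(4/5) / 2`.
  have h := le_randomizedQueryComplexity G (J := Unit) (fun _ => 1) (fun _ => zero_le_one) (by simp)
    (fun _ y => (G.dist u y : ℝ)) (fun _ y => (G.dist v y : ℝ)) 1 0
    (by
      rw [Fintype.sum_unique, if_neg]
      rintro ⟨b, hb1, hb2⟩
      exact huv ((hloc u b hb1).symm.trans (hloc v b hb2)))
    (by
      intro x
      rw [Fintype.sum_unique]
      split_ifs <;> norm_num) 0
  norm_num at h
  exact h

end Adversary

end LocalSearch

/-! ### Choice of parameters and the final bound. -/

namespace LocalSearch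

/-- The three terms are the union bound, the early visits and the late visits, and `28 = 6 + 6 +
16`. The first decreases and the third increases in `K`; `K ≈ √N` balances them. -/
theorem distinguishing_rate_le {N τ σ K : ℝ} (hN : 2 ≤ N) (hτ : 1 ≤ τ) (hlog : Real.log N ≤ τ)
    (hσ : 1 ≤ σ) (hK : √N ≤ K) (hK2 : K ≤ 2 * √N) :
    2 / K * ((Real.log (2 * N) + 2 * σ / N * (τ * σ) * K) / Real.log 2 +
      K * ((K * τ + 1) * (2 * σ / N))) ≤ 28 * σ ^ 2 * τ / √N := by
  set s := √N with hs
  have hs1 : 1 ≤ s := Real.one_le_sqrt.2 (by linarith)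
  have hs0 : 0 < s := by linarith
  have hNs : N = s * s := (Real.mul_self_sqrt (by linarith)).symm
  have hK0 : 0 < K := by linarith
  have hN0 : 0 < N := by linarith
  have hl2 : (2 / 3 : ℝ) ≤ Real.log 2 := by linarith [Real.log_two_gt_d9]
  have hl20 : 0 < Real.log 2 := by linarith
  have hlog2N : Real.log (2 * N) ≤ 2 * τ := by
    rw [Real.log_mul (by norm_num) hN0.ne']
    linarith [Real.log_le_log (by norm_num) hN]
  have hinv : ∀ a : ℝ, 0 ≤ a → a / Real.log 2 ≤ 3 / 2 * a := fun a ha => by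
    rw [div_le_iff₀ hl20]; nlinarith
  have h1 : 2 / K * (Real.log (2 * N) / Real.log 2) ≤ 6 * σ ^ 2 * τ / s := by
    calc 2 / K * (Real.log (2 * N) / Real.log 2) ≤ 2 / s * (3 / 2 * (2 * τ)) := by
          refine mul_le_mul (by gcongr) ?_
            (div_nonneg (Real.log_nonneg (by linarith)) hl20.le) (by positivity)
          exact (div_le_div_of_nonneg_right hlog2N hl20.le).trans (hinv _ (by linarith))
      _ = 6 * 1 ^ 2 * τ / s := by ring
      _ ≤ 6 * σ ^ 2 * τ / s := by gcongr
  have h2 : 2 / K * (2 * σ / N * (τ * σ) * K / Real.log 2) ≤ 6 * σ ^ 2 * τ / s := by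
    calc 2 / K * (2 * σ / N * (τ * σ) * K / Real.log 2) = 4 * σ ^ 2 * τ / N / Real.log 2 := by
          field_simp; ring
      _ ≤ 3 / 2 * (4 * σ ^ 2 * τ / N) := hinv _ (by positivity)
      _ = 6 * σ ^ 2 * τ / N := by ring
      _ ≤ 6 * σ ^ 2 * τ / s := by
          refine div_le_div_of_nonneg_left (by positivity) hs0 ?_
          rw [hNs]; nlinarith
  have h3 : 2 / K * (K * ((K * τ + 1) * (2 * σ / N))) ≤ 16 * σ ^ 2 * τ / s := by
    calc 2 / K * (K * ((K * τ + 1) * (2 * σ / N))) = 2 * ((K * τ + 1) * (2 * σ / N)) := by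
          field_simp
      _ ≤ 2 * ((2 * s * τ + 2 * s * τ) * (2 * σ / N)) := by
          have : K * τ + 1 ≤ 2 * s * τ + 2 * s * τ := by nlinarith
          gcongr
      _ = 16 * σ ^ 1 * τ / s := by rw [hNs]; field_simp; ring
      _ ≤ 16 * σ ^ 2 * τ / s := by gcongr; norm_num
  calc _ = 2 / K * (Real.log (2 * N) / Real.log 2) +
        2 / K * (2 * σ / N * (τ * σ) * K / Real.log 2) +
        2 / K * (K * ((K * τ + 1) * (2 * σ / N))) := by ring
    _ ≤ 6 * σ ^ 2 * τ / s + 6 * σ ^ 2 * τ / s + 16 * σ ^ 2 * τ / s := by linarith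
    _ = 28 * σ ^ 2 * τ / s := by ring

end LocalSearch

open LocalSearch in
theorem corollary1 :
    ∃ c : ℝ, 0 < c ∧
      ∀ (n : ℕ), 2 ≤ n →
      ∀ (G : SimpleGraph (Fin n)), G.Connected →
      ∀ (P : Matrix (Fin n) (Fin n) ℝ) (π : Fin n → ℝ),
        LocalSearch.IsChainOn G P →
        LocalSearch.IsStationary P π →
        LocalSearch.IsLazy P →
        LocalSearch.IsIrreducible P →
        LocalSearch.IsReversible P π →
        ENNReal.ofReal
            (c * ((1 - LocalSearch.secondEigenvalue P) * Real.sqrt (n : ℝ) /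
              (Real.log (n : ℝ) * Real.exp (3 * LocalSearch.maxRatio π)))) ≤
          LocalSearch.randomizedQueryComplexity G := by
  refine ⟨1 / 3500, by norm_num, ?_⟩
  intro n hn G hG P π hP hπ hlazy hirr hrev
  have hpos := hπ.pos hP hirr
  set l := secondEigenvalue P with hl
  set σ := maxRatio π with hσdef
  have hN : (2 : ℝ) ≤ n := by exact_mod_cast hn
  have hN0 : (0 : ℝ) < n := by linarith
  have hlog23 : (2 / 3 : ℝ) ≤ Real.log n := by
    linarith [Real.log_two_gt_d9, Real.log_le_log (by norm_num) hN]
  have hlog0 : 0 < Real.log n := by linarith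
  let u : Fin n := ⟨0, by omega⟩
  let v : Fin n := ⟨1, by omega⟩
  have hσ : 1 ≤ σ := one_le_maxRatio hpos u
  have hl0 : 0 ≤ l := secondEigenvalue_nonneg hn hP hlazy hpos hrev
  have hexp0 := Real.exp_pos (3 * σ)
  -- For `l ≥ 1` the claimed bound is nonpositive, so a strict spectral gap need not be derived from
  -- irreducibility.
  rcases le_or_gt 1 l with hl1 | hl1
  · rw [ENNReal.ofReal_of_nonpos]
    · exact zero_le
    · refine mul_nonpos_of_nonneg_of_nonpos (by norm_num) ?_
      refine div_nonpos_of_nonpos_of_nonneg ?_ (by positivity)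
      exact mul_nonpos_of_nonpos_of_nonneg (by linarith) (Real.sqrt_nonneg _)
  have hgap : 0 < 1 - l := by linarith
  have hs0 : 0 < √(n : ℝ) := Real.sqrt_pos.2 hN0
  have hs1 : 1 ≤ √(n : ℝ) := Real.one_le_sqrt.2 (by linarith)
  -- The threshold makes the endpoint collision probability `2σ / n` at most `2/5` in the second
  -- case.
  rcases lt_or_ge (n : ℝ) (5 * σ) with hsmall | hlarge
  · refine le_trans (ENNReal.ofReal_le_ofReal ?_)
      (le_randomizedQueryComplexity_of_ne hG (u := u) (v := v) (by simp [u, v]))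
    have hsq : √(n : ℝ) ≤ 5 * σ := by
      have := Real.mul_self_sqrt hN0.le
      nlinarith
    have hden : 2 / 3 * (3 * σ) ≤ Real.log n * Real.exp (3 * σ) :=
      mul_le_mul hlog23 (by linarith [Real.add_one_le_exp (3 * σ)]) (by linarith) hlog0.le
    have : (1 - l) * √(n : ℝ) / (Real.log n * Real.exp (3 * σ)) ≤ 5 / 2 := by
      rw [div_le_iff₀ (by positivity)]
      nlinarith
    linarith
  · set τ : ℕ := ⌈Real.log n / (1 - l)⌉₊ with hτ
    set K : ℕ := ⌈√(n : ℝ)⌉₊ with hK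
    have hτpos : 0 < τ := Nat.ceil_pos.2 (div_pos hlog0 hgap)
    have hKpos : 0 < K := Nat.ceil_pos.2 hs0
    have : NeZero τ := ⟨hτpos.ne'⟩
    have : NeZero K := ⟨hKpos.ne'⟩
    have hτle : Real.log n / (1 - l) ≤ τ := Nat.le_ceil _
    have hτlt : (τ : ℝ) < Real.log n / (1 - l) + 1 := Nat.ceil_lt_add_one (by positivity)
    have hlogle : Real.log n ≤ Real.log n / (1 - l) := by
      rw [le_div_iff₀ hgap]; nlinarith
    have hτ52 : (τ : ℝ) ≤ 5 / 2 * (Real.log n / (1 - l)) := by linarith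
    have hτ1 : (1 : ℝ) ≤ τ := by exact_mod_cast hτpos
    have hK1 : √(n : ℝ) ≤ K := Nat.le_ceil _
    have hK2 : (K : ℝ) ≤ 2 * √(n : ℝ) := by
      have := Nat.ceil_lt_add_one hs0.le
      linarith
    -- Here `70 = 28 * 5/2`, where `5/2` absorbs the rounding in `τ`, since `log n ≥ 2/3`.
    set Γ : ℝ := 70 * σ ^ 2 * (Real.log n / (1 - l)) / √(n : ℝ) with hΓ
    have hΓ0 : 0 < Γ := by positivity
    have hrate : 2 / (K : ℝ) * ((Real.log (2 * n) + 2 * σ / n * (τ * σ) * K) / Real.log 2 +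
        K * ((K * τ + 1) * (2 * σ / n))) ≤ Γ := by
      refine (distinguishing_rate_le hN hτ1 (hlogle.trans hτle) hσ hK1 hK2).trans ?_
      rw [hΓ]
      refine div_le_div_of_nonneg_right ?_ hs0.le
      nlinarith [sq_nonneg σ]
    have hmix : ∀ s, τ ≤ s → ∀ u x, (P ^ s) u x ≤ 2 * σ / n := by
      intro s hs u x
      refine pow_apply_le hn hP hπ hlazy hpos hrev hl1 s ?_ u x
      have : (τ : ℝ) ≤ s := by exact_mod_cast hs
      rw [div_le_iff₀ hgap] at hτle
      nlinarith
    -- Then `4/5 - 2/5 - 1/5 = 1/5` is left, and `3500 = 5 * 5 * 2 * 70`.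
    set T : ℕ := ⌊1 / 5 / Γ⌋₊ with hT
    have hTle : T * Γ ≤ 1 / 5 := by
      rw [← le_div_iff₀ hΓ0]
      exact Nat.floor_le (by positivity)
    have hTlt : 1 / 5 / Γ < (T : ℝ) + 1 := Nat.lt_floor_add_one _
    refine le_trans (ENNReal.ofReal_le_ofReal ?_) (le_randomizedQueryComplexity_of_chain hG hP
      (K := K) (2 * σ / n) σ hmix (sum_pow_apply_le hP hpos hrev) u T Γ hrate)
    have hδ : 2 * σ / n ≤ 2 / 5 := by
      rw [div_le_iff₀ hN0]; linarith
    have hσexp : σ ^ 2 ≤ Real.exp (3 * σ) := by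
      have h := Real.add_one_le_exp σ
      have h2 : Real.exp σ ^ 2 ≤ Real.exp (3 * σ) := by
        rw [← Real.exp_nat_mul]
        exact Real.exp_le_exp.2 (by push_cast; linarith)
      nlinarith
    calc 1 / 3500 * ((1 - l) * √(n : ℝ) / (Real.log n * Real.exp (3 * σ)))
        ≤ 1 / 3500 * ((1 - l) * √(n : ℝ) / (Real.log n * σ ^ 2)) := by gcongr
      _ = 1 / 5 / Γ * (1 / 5) / 2 := by
          rw [hΓ]; field_simp; norm_num
      _ ≤ (T + 1) * (4 / 5 - 2 * σ / n - T * Γ) / 2 := by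
          have : (1 / 5 : ℝ) ≤ 4 / 5 - 2 * σ / n - T * Γ := by linarith
          gcongr
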